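/- Fix $n\ge 0$, the order $1<\dots<n$ of the qubits, and consider states in $(\mathbb{C}^2)^{\otimes n}$ (not necessarily normalised). Write $\psi\cong\phi$ if $\psi=z\phi$ for some non-zero $z\in\mathbb{C}$. A non-zero vector $\psi$ is a \emph{stabilizer state} if it is determined, up to scalar, by the elements $i^kX^aZ^b$ of the $n$-qubit Pauli group that fix it. A set $F\subseteq[n]$ is a \emph{set of free variables} for $A\subseteq\mathbb{Z}_2^n$ if every assignment of values to the $x_j$, $j\in F$, extends to exactly one $x\in A$. The \emph{canonical set of free variables} of $A$ is found by considering $x_1,\dots,x_n$ in ascending order and declaring $x_j$ dependent if its value is fixed, by the requirement $x\in A$, given the values of the free variables among $x_1,\dots,x_{j-1}$, and free otherwise. A ZX-diagram with no inputs and $n$ outputs is in \emph{phase-polynomial form} if its output wires correspond one-to-one to its spiders, red (X) spiders have phases in $\{0,\pi\}$, green (Z) spiders have phases in $\frac{\pi}{2}\mathbb{Z}$ (phases are taken modulo $2\pi$), and every edge is either a plain edge between spiders of different colours or a Hadamard edge between green spiders, without loops or parallel edges. Diagrams that differ only by the names of spiders and edges are identified. $[\![D]\!]$ denotes the standard interpretation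 of $D$. Let $\psi$ be a stabilizer state with support $A$ and $F$ a set of free variables for $A$. A phase-polynomial form diagram $D$ is the \emph{translation} of $(\psi,F)$ if there are $a_k,c_{kj},s_{jj'}\in\mathbb{Z}_2$ and $r_j\in\mathbb{Z}_4$ such that $x_k=a_k\oplus\bigoplus_{j\in F}c_{kj}x_j$ for all $x\in A$ and $k\notin F$; $\psi\cong\sum_{x\in A}i^{p(x)}|x\rangle$ with $p(x)=\sum_{j\in F}r_jx_j+2\sum_{j,j'\in F,\,j<j'}s_{jj'}x_jx_{j'}$; and $D$ has, at output $j\in F$, a green spider of phase $r_j\frac{\pi}{2}$, at output $k\notin F$, a red spider of phase $a_k\pi$, a plain edge between $j\in F$ and $k\notin F$ exactly when $c_{kj}=1$, and a Hadamard edge between $j<j'$ in $F$ exactly when $s_{jj'}=1$. A \emph{canonical diagram} of $\psi$ is a translation of $(\psi,F)$ for the canonical set $F$ of free variables of the support of $\psi$; a diagram is in \emph{canonical form} if it is a canonical diagram of some stabilizer state. \textbf{Theorem (the canonical form is unique).} \begin{enumerate} \item Translation defines a bijection $\Phi$ from pairs $(\psi,F)$, where $\psi$ is an $n$-qubit stabilizer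 state up to non-zero scalar and $F$ is a set of free variables for its support, to phase-polynomial form diagrams with $n$ outputs; and if $D=\Phi(\psi,F)$ then $[\![D]\!]\cong\psi$. \item For every $n$-qubit stabilizer state $\psi$, the support of $\psi$ is an affine subspace of $\mathbb{Z}_2^n$, its canonical set $F$ of free variables is a set of free variables for it, and $\psi$ has exactly one canonical diagram, namely $\Phi(\psi,F)$. \item If $D$ and $D'$ are diagrams in canonical form with $[\![D]\!]\cong[\![D']\!]$, then $D=D'$. \end{enumerate} -/

import Mathlib

namespace ZXCalc

/-- A bit string `x = (x_1, …, x_n)`, i.e. a vector in `ℤ₂ⁿ`. The linear order of `Fin n` is the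
(fixed, top-to-bottom) order of the qubits. -/
abbrev Bits (n : ℕ) : Type := Fin n → ZMod 2

/-- A vector of the `n`-qubit state space, given by its amplitudes in the computational basis:
`ψ x` is the amplitude `⟨x|ψ⟩`. -/
abbrev State (n : ℕ) : Type := Bits n → ℂ

/-- `ψ ≅ φ`: equality up to a non-zero scalar factor. -/
def EqUpToScalar {n : ℕ} (ψ φ : State n) : Prop :=
  ∃ z : ℂ, z ≠ 0 ∧ ψ = z • φ

theorem EqUpToScalar.refl {n : ℕ} (ψ : State n) : EqUpToScalar ψ ψ :=
  ⟨1, one_ne_zero, (one_smul ℂ ψ).symm⟩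

theorem EqUpToScalar.symm {n : ℕ} {ψ φ : State n} (h : EqUpToScalar ψ φ) : EqUpToScalar φ ψ := by
  obtain ⟨z, hz, rfl⟩ := h
  exact ⟨z⁻¹, inv_ne_zero hz, by rw [smul_smul, inv_mul_cancel₀ hz, one_smul]⟩

theorem EqUpToScalar.trans {n : ℕ} {ψ φ χ : State n} (h : EqUpToScalar ψ φ)
    (h' : EqUpToScalar φ χ) : EqUpToScalar ψ χ := by
  obtain ⟨z, hz, rfl⟩ := h
  obtain ⟨w, hw, rfl⟩ := h'
  exact ⟨z * w, mul_ne_zero hz hw, by rw [smul_smul]⟩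

/-! ### Stabilizer states -/

/-- The action of the `n`-qubit Pauli operator `i^k X^a Z^b`, where
`X^a Z^b |y⟩ = (-1)^{b·y} |y ⊕ a⟩`. With `k ∈ ℤ₄` and `a, b ∈ ℤ₂ⁿ` these are all the elements of the
`n`-qubit Pauli group (`Y = i X Z`). -/
noncomputable def pauli {n : ℕ} (k : ZMod 4) (a b : Bits n) (ψ : State n) : State n :=
  fun x => Complex.I ^ k.val * (-1 : ℂ) ^ (∑ j, b j * (x j + a j)).val * ψ (x + a)

/-- A (not necessarily normalised) stabilizer state: a non-zero vector that is determined, up to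
scalar, by the Pauli group elements which fix it. -/
def IsStabilizerState {n : ℕ} (ψ : State n) : Prop :=
  ψ ≠ 0 ∧
    ∀ φ : State n,
      (∀ (k : ZMod 4) (a b : Bits n), pauli k a b ψ = ψ → pauli k a b φ = φ) →
        ∃ c : ℂ, φ = c • ψ

/-! ### Free variables -/

/-- `F` is a set of free variables for `A`: every assignment of values to the variables in `F`
extends to exactly one element of `A`. -/
def IsFreeVariableSet {n : ℕ} (A : Set (Bits n)) (F : Finset (Fin n)) : Prop :=
  ∀ y : F → ZMod 2, ∃! x : Bits n, x ∈ A ∧ ∀ j : F, x j = y j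

/-- The value of `x_j` is fixed by the requirement `x ∈ A`, given the values of the variables
in `S`. -/
def IsFixedGiven {n : ℕ} (A : Set (Bits n)) (S : Finset (Fin n)) (j : Fin n) : Prop :=
  ∀ x ∈ A, ∀ y ∈ A, (∀ k ∈ S, x k = y k) → x j = y j

open Classical in
/-- The free variables found by the canonical procedure among the first `m` variables: the variables
are considered in ascending order, and a variable is free unless its value is fixed given the
values of the free variables found before it. -/
noncomputable def canonicalFreeAux {n : ℕ} (A : Set (Bits n)) : ℕ → Finset (Fin n)
  | 0 => ∅
  | m + 1 => canonicalFreeAux A m ∪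
      Finset.univ.filter (fun j => j.val = m ∧ ¬ IsFixedGiven A (canonicalFreeAux A m) j)

/-- The canonical set of free variables of `A`. -/
noncomputable def canonicalFree {n : ℕ} (A : Set (Bits n)) : Finset (Fin n) :=
  canonicalFreeAux A n

/-- The phase polynomial `p(x) = ∑_{j ∈ F} r_j x_j + 2 ∑_{j,k ∈ F, j < k} s_{jk} x_j x_k`,
with values in `ℤ₄`. -/
def phasePoly {n : ℕ} (F : Finset (Fin n)) (r : Fin n → ZMod 4) (s : Fin n → Fin n → ZMod 2)
    (x : Bits n) : ZMod 4 :=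
  ∑ j ∈ F, r j * ((x j).val : ZMod 4) +
    2 * ∑ j ∈ F, ∑ k ∈ F.filter (fun k => j < k),
      ((s j k).val : ZMod 4) * ((x j).val : ZMod 4) * ((x k).val : ZMod 4)

/-! ### ZX-diagrams -/

/-- The colours of spiders: green spiders are Z-spiders, red spiders are X-spiders. -/
inductive Colour : Type
  | green
  | red

/-- A ZX-diagram without inputs and with `n` output wires (a state diagram): a finite set of spiders,
a finite set of edges between them (parallel edges and loops are allowed), each of which is plain or
carries a Hadamard node, and for every output the spider which its wire is connected to. The
direction of an edge has no meaning, see `ZXDiagram.Iso`. Phases are angles, i.e. reals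
modulo `2π`. -/
structure ZXDiagram (n : ℕ) where
  Spider : Type
  Edge : Type
  fintypeSpider : Fintype Spider
  fintypeEdge : Fintype Edge
  colour : Spider → Colour
  phase : Spider → Real.Angle
  src : Edge → Spider
  tgt : Edge → Spider
  hadamard : Edge → Bool
  out : Fin n → Spider

attribute [instance] ZXDiagram.fintypeSpider ZXDiagram.fintypeEdge

/-- The matrix entry `⟨a|H|b⟩` of the Hadamard gate. -/
noncomputable def hadamardEntry (a b : ZMod 2) : ℂ :=
  (1 / (Real.sqrt 2 : ℂ)) * (-1 : ℂ) ^ (a * b).val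

/-- The matrix entry `⟨a|b⟩` of the identity wire. -/
def wireEntry (a b : ZMod 2) : ℂ :=
  if a = b then 1 else 0

/-- The amplitude `⟨x|b_s⟩` of a leg of a spider, where `b_0, b_1` is the basis `|0⟩, |1⟩` for a
green spider and the basis `|+⟩, |-⟩` for a red spider. -/
noncomputable def legEntry : Colour → ZMod 2 → ZMod 2 → ℂ
  | Colour.green, s, x => wireEntry x s
  | Colour.red, s, x => hadamardEntry x s

namespace ZXDiagram

open Classical in
/-- The tensor of the spider `v`, namely `|b_0 ⋯ b_0⟩ + e^{iα} |b_1 ⋯ b_1⟩`, evaluated at the bits on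
the legs of `v`. The two components of `σ e` are the bits at the two ends of the edge `e`, and `x j`
is the bit on the output wire `j`. -/
noncomputable def spiderTensor {n : ℕ} (D : ZXDiagram n)
    (σ : D.Edge → ZMod 2 × ZMod 2) (x : Bits n) (v : D.Spider) : ℂ :=
  ∑ s : ZMod 2,
    (if s = 0 then 1 else ((D.phase v).toCircle : ℂ)) *
      (∏ e with D.src e = v, legEntry (D.colour v) s (σ e).1) *
      (∏ e with D.tgt e = v, legEntry (D.colour v) s (σ e).2) *
      (∏ j with D.out j = v, legEntry (D.colour v) s (x j))

/-- The matrix entry of the edge `e`. -/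
noncomputable def edgeTensor {n : ℕ} (D : ZXDiagram n)
    (σ : D.Edge → ZMod 2 × ZMod 2) (e : D.Edge) : ℂ :=
  if D.hadamard e = true then hadamardEntry (σ e).1 (σ e).2 else wireEntry (σ e).1 (σ e).2

open Classical in
/-- The standard interpretation `⟦D⟧` of a ZX-diagram: the contraction of the tensors of all spiders
and edges. -/
noncomputable def interp {n : ℕ} (D : ZXDiagram n) : State n :=
  fun x => ∑ σ : D.Edge → ZMod 2 × ZMod 2,
    (∏ v, D.spiderTensor σ x v) * ∏ e, D.edgeTensor σ e

/-- There is a plain edge connecting `v` and `w`. -/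
def PlainAdj {n : ℕ} (D : ZXDiagram n) (v w : D.Spider) : Prop :=
  ∃ e, D.hadamard e = false ∧ s(D.src e, D.tgt e) = s(v, w)

/-- There is a Hadamard edge connecting `v` and `w`. -/
def HadamardAdj {n : ℕ} (D : ZXDiagram n) (v w : D.Spider) : Prop :=
  ∃ e, D.hadamard e = true ∧ s(D.src e, D.tgt e) = s(v, w)

/-- Two diagrams are the same diagram: they differ only by the names of their spiders and edges and
by the direction in which the edges are listed. -/
def Iso {n : ℕ} (D D' : ZXDiagram n) : Prop :=
  ∃ (f : D.Spider ≃ D'.Spider) (g : D.Edge ≃ D'.Edge),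
    (∀ v, D'.colour (f v) = D.colour v) ∧
    (∀ v, D'.phase (f v) = D.phase v) ∧
    (∀ e, s(D'.src (g e), D'.tgt (g e)) = s(f (D.src e), f (D.tgt e))) ∧
    (∀ e, D'.hadamard (g e) = D.hadamard e) ∧
    (∀ j, D'.out j = f (D.out j))

theorem Iso.refl {n : ℕ} (D : ZXDiagram n) : D.Iso D :=
  ⟨Equiv.refl _, Equiv.refl _, fun _ => rfl, fun _ => rfl, fun _ => rfl, fun _ => rfl, fun _ => rfl⟩

theorem Iso.symm {n : ℕ} {D D' : ZXDiagram n} (h : D.Iso D') : D'.Iso D := by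
  obtain ⟨f, g, h1, h2, h3, h4, h5⟩ := h
  refine ⟨f.symm, g.symm, fun v => ?_, fun v => ?_, fun e => ?_, fun e => ?_, fun j => ?_⟩
  · simpa using (h1 (f.symm v)).symm
  · simpa using (h2 (f.symm v)).symm
  · have := congrArg (Sym2.map f.symm) (h3 (g.symm e))
    simpa using this.symm
  · simpa using (h4 (g.symm e)).symm
  · rw [h5, Equiv.symm_apply_apply]

theorem Iso.trans {n : ℕ} {D D' D'' : ZXDiagram n} (h : D.Iso D') (h' : D'.Iso D'') :
    D.Iso D'' := by
  obtain ⟨f, g, h1, h2, h3, h4, h5⟩ := h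
  obtain ⟨f', g', k1, k2, k3, k4, k5⟩ := h'
  refine ⟨f.trans f', g.trans g', fun v => ?_, fun v => ?_, fun e => ?_, fun e => ?_, fun j => ?_⟩
  · simp [k1, h1]
  · simp [k2, h2]
  · have := congrArg (Sym2.map f') (h3 e)
    simp only [Sym2.map_mk] at this
    simp [k3, this]
  · simp [k4, h4]
  · simp [k5, h5]

/-- Phase-polynomial form. As usual for this form, no two edges are parallel and there are no loops
(they could be removed without changing the interpretation up to scalar). -/
structure IsPhasePolyForm {n : ℕ} (D : ZXDiagram n) : Prop where
  /-- The dangling edges correspond one-to-one to the spiders. -/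
  out_bijective : Function.Bijective D.out
  /-- Red spiders have phase `0` or `π`. -/
  red_phase : ∀ v, D.colour v = Colour.red →
    D.phase v = 0 ∨ D.phase v = ((Real.pi : ℝ) : Real.Angle)
  /-- Green spiders have phases that are integer multiples of `π/2`. -/
  green_phase : ∀ v, D.colour v = Colour.green →
    ∃ m : ℤ, D.phase v = ((m * (Real.pi / 2) : ℝ) : Real.Angle)
  /-- Plain edges connect spiders of different colours. -/
  plain_edge : ∀ e, D.hadamard e = false → D.colour (D.src e) ≠ D.colour (D.tgt e)
  /-- Hadamard edges connect green spiders. -/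
  hadamard_edge : ∀ e, D.hadamard e = true →
    D.colour (D.src e) = Colour.green ∧ D.colour (D.tgt e) = Colour.green
  /-- There are no loops. -/
  no_loops : ∀ e, D.src e ≠ D.tgt e
  /-- There are no parallel edges. -/
  no_parallel : ∀ e e', s(D.src e, D.tgt e) = s(D.src e', D.tgt e') → e = e'

/-- The phase-polynomial form diagram `D` is the translation of the pair `(ψ, F)`:

* `A`, the support of `ψ`, satisfies `x_k = a_k ⊕ ⨁_{j ∈ F} c_{kj} x_j` for all `k ∉ F`;
* `ψ ≅ ∑_{x ∈ A} i^{p(x)} |x⟩` for the phase polynomial `p` over `F` with coefficients `r` and `s`;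
* `D` has a green spider with phase `r_j π/2` for `j ∈ F`, a red spider with phase `a_k π`
  for `k ∉ F`, a plain edge between `j ∈ F` and `k ∉ F` exactly when `c_{kj} = 1`, and a Hadamard edge
  between `j ∈ F` and `j' ∈ F`, `j < j'`, exactly when `s_{jj'} = 1`. -/
def IsTranslation {n : ℕ} (D : ZXDiagram n) (ψ : State n) (F : Finset (Fin n)) : Prop :=
  D.IsPhasePolyForm ∧
  ∃ (a : Fin n → ZMod 2) (c : Fin n → Fin n → ZMod 2)
    (r : Fin n → ZMod 4) (s : Fin n → Fin n → ZMod 2),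
    (∀ k, k ∉ F → ∀ x ∈ Function.support ψ, x k = a k + ∑ j ∈ F, c k j * x j) ∧
    (∃ z : ℂ, z ≠ 0 ∧
      ∀ x ∈ Function.support ψ, ψ x = z * Complex.I ^ (phasePoly F r s x).val) ∧
    (∀ j, j ∈ F → D.colour (D.out j) = Colour.green) ∧
    (∀ k, k ∉ F → D.colour (D.out k) = Colour.red) ∧
    (∀ j, j ∈ F → D.phase (D.out j) = (((r j).val * (Real.pi / 2) : ℝ) : Real.Angle)) ∧
    (∀ k, k ∉ F → D.phase (D.out k) = (((a k).val * Real.pi : ℝ) : Real.Angle)) ∧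
    (∀ j k, j ∈ F → k ∉ F → (D.PlainAdj (D.out j) (D.out k) ↔ c k j = 1)) ∧
    (∀ j j', j ∈ F → j' ∈ F → j < j' → (D.HadamardAdj (D.out j) (D.out j') ↔ s j j' = 1))

/-- `D` is a canonical diagram of the state `ψ`: it is the translation of `(ψ, F)`, where `F` is the
canonical set of free variables of the support of `ψ`. -/
def IsCanonicalDiagram {n : ℕ} (D : ZXDiagram n) (ψ : State n) : Prop :=
  D.IsTranslation ψ (canonicalFree (Function.support ψ))

/-- `D` is in canonical form: it is a canonical diagram of some stabilizer state. -/
def IsCanonicalForm {n : ℕ} (D : ZXDiagram n) : Prop :=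
  ∃ ψ : State n, IsStabilizerState ψ ∧ D.IsCanonicalDiagram ψ

end ZXDiagram

/-! ### Diagrams up to isomorphism and pairs up to scalars -/

instance phasePolySetoid (n : ℕ) : Setoid {D : ZXDiagram n // D.IsPhasePolyForm} where
  r D D' := D.1.Iso D'.1
  iseqv := ⟨fun D => .refl D.1, fun h => h.symm, fun h h' => h.trans h'⟩

/-- The phase-polynomial form diagrams with `n` outputs, where diagrams which differ only by the names
of their spiders and edges are identified. -/
abbrev PhasePolyDiagram (n : ℕ) : Type 1 := Quotient (phasePolySetoid n)

/-- A pair `(ψ, F)` of an `n`-qubit stabilizer state and a set of free variables for its support. -/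
structure StabilizerPair (n : ℕ) where
  state : State n
  free : Finset (Fin n)
  isStabilizerState : IsStabilizerState state
  isFreeVariableSet : IsFreeVariableSet (Function.support state) free

instance stabilizerPairSetoid (n : ℕ) : Setoid (StabilizerPair n) where
  r P Q := EqUpToScalar P.state Q.state ∧ P.free = Q.free
  iseqv := ⟨fun P => ⟨.refl P.state, rfl⟩, fun h => ⟨h.1.symm, h.2.symm⟩,
    fun h h' => ⟨h.1.trans h'.1, h.2.trans h'.2⟩⟩

/-- Pairs `(ψ, F)` up to non-zero scalar factors of `ψ`. -/
abbrev StabilizerPairUpToScalar (n : ℕ) : Type := Quotient (stabilizerPairSetoid n)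

end ZXCalc

open ZXCalc

namespace ZXCalc

/-! Everything reduces to the explicit states `phaseState F a c r s`: amplitude `i^{p(x)}` on the
affine set cut out by the equations for the dependent variables, zero elsewhere.

These are exactly the stabilizer states with free variables `F`, up to scalar. A translation along
the affine set changes the quadratic `p` by an affine function, which a Pauli operator undoes;
together with the parity checks these operators determine the state
(`isStabilizerState_phaseState`). Conversely, the support of a stabilizer state is one coset of the
group of Pauli shifts (`IsStabilizerState.mem_support_iff`), and walking through it along a basis
dual to `F` accumulates linear and quadratic phases (`IsStabilizerState.exists_eq_smul_phaseState`).

The coefficients are recovered from the state by evaluating at points with at most two free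
variables equal to 1 (`coeffsAgree_of_eqUpToScalar`), and they determine the diagram because edges
are simple (`HasCoeffs.iso`). The diagram denotes the state because summing over the label of a red
spider imposes its affine equation (`interp_coeffDiagram`). Hence translation is a bijection.

The canonical `F` depends only on the support, so equivalent canonical diagrams are translations of
the same pair. -/

/-- The additive character `a ↦ i^a` of `ℤ₄`. -/
noncomputable def iChar : AddChar (ZMod 4) ℂ :=
  AddChar.zmodChar 4 (ζ := Complex.I) Complex.I_pow_four

theorem iChar_apply (a : ZMod 4) : iChar a = Complex.I ^ a.val :=
  AddChar.zmodChar_apply _ a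

theorem iChar_ne_zero (a : ZMod 4) : iChar a ≠ 0 := by
  rw [iChar_apply]; exact pow_ne_zero _ Complex.I_ne_zero

theorem iChar_injective : Function.Injective iChar := by
  intro a b h
  rw [iChar_apply, iChar_apply] at h
  have ha := ZMod.val_lt a
  have hb := ZMod.val_lt b
  apply ZMod.val_injective
  generalize a.val = m at *
  generalize b.val = k at *
  have h1 : ((-1 : ℂ) = 1) ↔ False := by norm_num
  interval_cases m <;> interval_cases k <;>
    simp [Complex.ext_iff, pow_succ] at h ⊢ <;> norm_num at h

/-- The embedding `b ↦ 2 b` of `ℤ₂` into `ℤ₄`. -/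
def double : ZMod 2 →+ ZMod 4 where
  toFun b := 2 * (b.val : ZMod 4)
  map_zero' := by decide
  map_add' := by decide

theorem double_injective : Function.Injective double := by
  intro a b; revert a b; decide

/-- Signs become values of the same character as the phases, so products of amplitudes turn into
sums in `ℤ₄`. -/
theorem iChar_double (b : ZMod 2) : iChar (double b) = (-1 : ℂ) ^ b.val := by
  rw [iChar_apply]
  have : (double b).val = 2 * b.val := by revert b; decide
  rw [this, pow_mul, Complex.I_sq]

theorem two_cases (b : ZMod 2) : b = 0 ∨ b = 1 := by revert b; decide

theorem bits_add_self {n : ℕ} (x : Bits n) : x + x = 0 := by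
  funext j; exact CharTwo.add_self_eq_zero (x j)

theorem bits_add_add_cancel {n : ℕ} (x y : Bits n) : x + (x + y) = y := by
  rw [← add_assoc, bits_add_self, zero_add]

theorem pauli_apply {n : ℕ} (k : ZMod 4) (a b : Bits n) (ψ : State n) (x : Bits n) :
    pauli k a b ψ x = iChar (k + double (∑ j, b j * (x j + a j))) * ψ (x + a) := by
  rw [AddChar.map_add_eq_mul, iChar_double, iChar_apply]; rfl

/-! ### Phase polynomials under translation and at indicator vectors. -/

theorem phasePoly_eq {n : ℕ} (F : Finset (Fin n)) (r : Fin n → ZMod 4) (s : Fin n → Fin n → ZMod 2)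
    (x : Bits n) :
    phasePoly F r s x = ∑ j ∈ F, r j * ((x j).val : ZMod 4) +
      ∑ j ∈ F, ∑ k ∈ F with j < k, double (s j k * x j * x k) := by
  unfold phasePoly
  simp only [Finset.mul_sum]
  congr 1
  refine Finset.sum_congr rfl fun j _ => Finset.sum_congr rfl fun k _ => ?_
  generalize s j k = a
  generalize x j = b
  generalize x k = c
  revert a b c; decide

/-- The polarisation of `p` takes values in `2ℤ₄` and is linear over `ℤ₂` in `x`: the carry in `x_j
⊕ v_j = x_j + v_j - 2 x_j v_j` contributes `2 r_j v_j x_j`, and the quadratic terms contribute their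
cross terms. A string of Z operators can therefore cancel it. -/
theorem phasePoly_add {n : ℕ} (F : Finset (Fin n)) (r : Fin n → ZMod 4)
    (s : Fin n → Fin n → ZMod 2) (v : Bits n) :
    ∃ b : Bits n, ∀ x, phasePoly F r s (x + v) =
      phasePoly F r s x + phasePoly F r s v + double (∑ j, b j * x j) := by
  -- `L` is half of the polarisation at `v`; `b` lists its values on the standard basis.
  let L : Bits n →ₗ[ZMod 2] ZMod 2 :=
    ∑ j ∈ F, (((r j).val : ZMod 2) * v j) • LinearMap.proj j +
      ∑ j ∈ F, ∑ k ∈ F with j < k, s j k • (v k • LinearMap.proj j + v j • LinearMap.proj k)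
  refine ⟨fun j => L (Pi.single j 1), fun x => ?_⟩
  have hL : ∑ j, L (Pi.single j 1) * x j = L x := by
    conv_rhs => rw [pi_eq_sum_univ' x, map_sum]
    refine Finset.sum_congr rfl fun j _ => ?_
    rw [map_smul, smul_eq_mul, mul_comm]
  have hlin : ∀ (r : ZMod 4) (x v : ZMod 2), r * ((x + v).val : ZMod 4) =
      r * (x.val : ZMod 4) + r * (v.val : ZMod 4) + double ((r.val : ZMod 2) * v * x) := by decide
  rw [hL]
  simp only [phasePoly_eq, Pi.add_apply, hlin, Finset.sum_add_distrib, L, LinearMap.add_apply,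
    LinearMap.sum_apply, LinearMap.smul_apply, LinearMap.proj_apply, smul_eq_mul, map_add, map_sum]
  have hq : ∀ j k, double (s j k * (x j + v j) * (x k + v k)) = double (s j k * x j * x k) +
      double (s j k * v j * v k) + double (s j k * (v k * x j + v j * x k)) := by
    intro j k
    rw [← map_add, ← map_add]; congr 1; ring
  simp only [hq, Finset.sum_add_distrib]
  abel

theorem phasePoly_congr {n : ℕ} {F : Finset (Fin n)} (r : Fin n → ZMod 4)
    (s : Fin n → Fin n → ZMod 2) {x y : Bits n} (h : ∀ j ∈ F, x j = y j) :
    phasePoly F r s x = phasePoly F r s y := by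
  rw [phasePoly_eq, phasePoly_eq]
  congr 1
  · exact Finset.sum_congr rfl fun j hj => by rw [h j hj]
  · refine Finset.sum_congr rfl fun j hj => Finset.sum_congr rfl fun k hk => ?_
    rw [h j hj, h k (Finset.mem_filter.1 hk).1]

theorem phasePoly_indicator {n : ℕ} {F T : Finset (Fin n)} (hT : T ⊆ F) (r : Fin n → ZMod 4)
    (s : Fin n → Fin n → ZMod 2) {x : Bits n} (hx : ∀ j ∈ F, x j = if j ∈ T then 1 else 0) :
    phasePoly F r s x = ∑ j ∈ T, r j + ∑ j ∈ T, ∑ k ∈ T with j < k, double (s j k) := by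
  rw [phasePoly_eq]
  congr 1
  · symm
    apply Finset.sum_subset_zero_on_sdiff hT
    · intro j hj
      rw [Finset.mem_sdiff] at hj
      simp [hx j hj.1, hj.2]
    · intro j hj
      simp [hx j (hT hj), hj, ZMod.val_one]
  · symm
    apply Finset.sum_subset_zero_on_sdiff hT
    · intro j hj
      rw [Finset.mem_sdiff] at hj
      simp [hx j hj.1, hj.2]
    · intro j hj
      apply Finset.sum_subset_zero_on_sdiff (Finset.filter_subset_filter _ hT)
      · intro k hk
        simp only [Finset.mem_sdiff, Finset.mem_filter, not_and_or] at hk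
        have : k ∉ T := by tauto
        simp [hx k hk.1.1, this]
      · intro k hk
        rw [Finset.mem_filter] at hk
        simp [hx j (hT hj), hx k (hT hk.1), hj, hk.1]

/-! ### The state given by the coefficients of an affine subspace and a phase polynomial -/

/-- The affine subspace with free variables `F` in which the other variables are given by
`x_k = a_k ⊕ ⨁_{j ∈ F} c_{kj} x_j`. -/
def affineSet {n : ℕ} (F : Finset (Fin n)) (a : Fin n → ZMod 2) (c : Fin n → Fin n → ZMod 2) :
    Set (Bits n) :=
  {x | ∀ k, k ∉ F → x k = a k + ∑ j ∈ F, c k j * x j}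

open Classical in
/-- The state `∑_{x ∈ A} i^{p(x)} |x⟩`. -/
noncomputable def phaseState {n : ℕ} (F : Finset (Fin n)) (a : Fin n → ZMod 2)
    (c : Fin n → Fin n → ZMod 2) (r : Fin n → ZMod 4) (s : Fin n → Fin n → ZMod 2) : State n :=
  fun x => if x ∈ affineSet F a c then iChar (phasePoly F r s x) else 0

section phaseState

variable {n : ℕ} (F : Finset (Fin n)) (a : Fin n → ZMod 2) (c : Fin n → Fin n → ZMod 2)
  (r : Fin n → ZMod 4) (s : Fin n → Fin n → ZMod 2)

theorem support_phaseState : Function.support (phaseState F a c r s) = affineSet F a c := by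
  ext x
  by_cases h : x ∈ affineSet F a c <;> simp [phaseState, h, iChar_ne_zero]

theorem isFreeVariableSet_affineSet : IsFreeVariableSet (affineSet F a c) F := by
  intro y
  let z : Fin n → ZMod 2 := fun j => if h : j ∈ F then y ⟨j, h⟩ else 0
  have hz : ∀ j : F, z j = y j := fun j => by simp [z]
  refine ⟨fun k => if k ∈ F then z k else a k + ∑ j ∈ F, c k j * z j, ⟨?_, ?_⟩, ?_⟩
  · intro k hk
    simp only [hk, if_false]
    congr 1
    exact Finset.sum_congr rfl fun j hj => by simp [hj]
  · intro j
    simp [j.2, hz]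
  · rintro x ⟨hx, hxy⟩
    have hxz : ∀ j ∈ F, x j = z j := fun j hj => by rw [hxy ⟨j, hj⟩, ← hz]
    funext k
    by_cases hk : k ∈ F
    · simp [hk, hxz]
    · simp only [hk, if_false]
      rw [hx k hk]
      congr 1
      exact Finset.sum_congr rfl fun j hj => by rw [hxz j hj]

/-- Stated with `x + x' = y + y'` so that a shift by `x + y` can be followed in both directions. -/
theorem mem_affineSet_add {x x' y y' : Bits n} (hx : x ∈ affineSet F a c)
    (hx' : x' ∈ affineSet F a c) (hy : y ∈ affineSet F a c) (h : x + x' = y + y') :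
    y' ∈ affineSet F a c := by
  intro k hk
  have e : y' = x + x' + y := by rw [h, add_comm y, add_assoc, bits_add_self, add_zero]
  have h2 : a k + a k = 0 := CharTwo.add_self_eq_zero _
  rw [e]
  simp only [Pi.add_apply, mul_add, Finset.sum_add_distrib]
  rw [hx k hk, hx' k hk, hy k hk]
  linear_combination h2

theorem exists_pauli_phaseState {x y : Bits n} (hx : x ∈ affineSet F a c)
    (hy : y ∈ affineSet F a c) :
    ∃ k b, pauli k (x + y) b (phaseState F a c r s) = phaseState F a c r s := by
  obtain ⟨b, hb⟩ := phasePoly_add F r s (x + y)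
  -- The scalar cancels `p` at the shift and the sign that arises because `pauli` evaluates `b` at
  -- the shifted point.
  refine ⟨-phasePoly F r s (x + y) - double (∑ j, b j * (x j + y j)), b, funext fun z => ?_⟩
  rw [pauli_apply]
  have hz : z + (x + y) ∈ affineSet F a c ↔ z ∈ affineSet F a c := by
    constructor <;> intro h
    · exact mem_affineSet_add F a c hx hy h (by rw [add_comm z, add_assoc, bits_add_self, add_zero])
    · exact mem_affineSet_add F a c hx hy h (by rw [bits_add_add_cancel])
  by_cases h : z ∈ affineSet F a c
  · simp only [phaseState, hz.2 h, h, if_true]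
    rw [← AddChar.map_add_eq_mul, hb]
    congr 1
    have h2 : double (∑ j, b j * z j) + double (∑ j, b j * z j) = 0 := by
      rw [← map_add, CharTwo.add_self_eq_zero, map_zero]
    simp only [Pi.add_apply, mul_add, Finset.sum_add_distrib, map_add] at h2 ⊢
    linear_combination h2
  · simp [phaseState, h, hz]

/-- Fixing Pauli operators with shift `x₀ + x` tie the amplitude of `φ` at `x` to the one at `x₀`.
Outside the affine set some parity check fails, and the corresponding Z-type operator forces `φ x =
-φ x`. -/
theorem isStabilizerState_phaseState : IsStabilizerState (phaseState F a c r s) := by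
  obtain ⟨x₀, ⟨hx₀, -⟩, -⟩ := isFreeVariableSet_affineSet F a c 0
  have hψ₀ : phaseState F a c r s x₀ ≠ 0 := by
    have : x₀ ∈ Function.support (phaseState F a c r s) := by rwa [support_phaseState]
    exact this
  refine ⟨fun h => hψ₀ (by rw [h]; rfl), fun φ hφ => ⟨φ x₀ / phaseState F a c r s x₀, ?_⟩⟩
  funext x
  by_cases hx : x ∈ affineSet F a c
  · obtain ⟨k, b, hkb⟩ := exists_pauli_phaseState F a c r s hx₀ hx
    have h1 := congrFun hkb x₀
    have h2 := congrFun (hφ _ _ _ hkb) x₀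
    rw [pauli_apply, bits_add_add_cancel] at h1 h2
    have h3 := iChar_ne_zero (k + double (∑ j, b j * (x₀ j + (x₀ + x) j)))
    rw [Pi.smul_apply, smul_eq_mul, div_mul_eq_mul_div, eq_div_iff hψ₀, ← h1, ← h2]
    ring
  · have hψx : phaseState F a c r s x = 0 := by simp [phaseState, hx]
    rw [Pi.smul_apply, hψx, smul_zero]
    simp only [affineSet, Set.mem_ofPred_eq, not_forall] at hx
    obtain ⟨k, hk, hxk⟩ := hx
    -- The parity check of the violated equation for `x_k`; its constant `a k` goes into the sign of
    -- the operator.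
    let b : Bits n := fun j => (if j = k then 1 else 0) + (if j ∈ F then c k j else 0)
    have hb : ∀ y : Bits n, ∑ j, b j * (y j + (0 : Bits n) j) = y k + ∑ j ∈ F, c k j * y j := by
      intro y
      simp [b, add_mul, Finset.sum_add_distrib]
    have hfix : pauli (double (a k)) 0 b (phaseState F a c r s) = phaseState F a c r s := by
      funext y
      rw [pauli_apply, hb, add_zero, ← map_add]
      by_cases hy : y ∈ affineSet F a c
      · have : a k + (y k + ∑ j ∈ F, c k j * y j) = 0 := by
          have := hy k hk
          rw [add_left_comm, ← this, CharTwo.add_self_eq_zero]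
        rw [this, map_zero, AddChar.map_zero_eq_one, one_mul]
      · simp [phaseState, hy]
    have h := congrFun (hφ _ _ _ hfix) x
    rw [pauli_apply, hb, add_zero, ← map_add] at h
    have : a k + (x k + ∑ j ∈ F, c k j * x j) = 1 := by
      refine (two_cases _).resolve_left fun h0 => hxk ?_
      rw [← CharTwo.add_eq_zero, ← h0]; ring
    rw [this, iChar_double] at h
    simp only [ZMod.val_one, pow_one, neg_mul, one_mul] at h
    exact self_eq_neg.1 h.symm

end phaseState

/-! ### Stabilizer states are given by affine subspaces and phase polynomials -/

/-- The directions `v` such that the translation by `v` is part of a Pauli operator fixing `ψ`. -/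
def pauliShifts {n : ℕ} (ψ : State n) : AddSubgroup (Bits n) where
  carrier := {v | ∃ (k : ZMod 4) (b : Bits n), ∀ x,
    ψ (x + v) = iChar (k + double (∑ j, b j * x j)) * ψ x}
  zero_mem' := ⟨0, 0, fun x => by simp⟩
  add_mem' := by
    rintro v w ⟨k, b, h⟩ ⟨k', b', h'⟩
    refine ⟨k + k' + double (∑ j, b' j * v j), b + b', fun x => ?_⟩
    rw [← add_assoc, h', h, ← mul_assoc, ← AddChar.map_add_eq_mul]
    congr 2
    simp only [Pi.add_apply, mul_add, add_mul, Finset.sum_add_distrib, map_add]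
    abel
  neg_mem' := by
    intro v h
    rwa [neg_eq_of_add_eq_zero_left (bits_add_self v)]

theorem mem_pauliShifts_of_pauli {n : ℕ} {ψ : State n} {k : ZMod 4} {a b : Bits n}
    (h : pauli k a b ψ = ψ) : a ∈ pauliShifts ψ := by
  refine ⟨-(k + double (∑ j, b j * a j)), b, fun x => ?_⟩
  have hx := congrFun h x
  rw [pauli_apply] at hx
  rw [← hx, ← mul_assoc, ← AddChar.map_add_eq_mul]
  have h2 : double (∑ j, b j * x j) + double (∑ j, b j * x j) = 0 := by
    rw [← map_add, CharTwo.add_self_eq_zero, map_zero]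
  have : -(k + double (∑ j, b j * a j)) + double (∑ j, b j * x j) +
      (k + double (∑ j, b j * (x j + a j))) = 0 := by
    simp only [mul_add, Finset.sum_add_distrib, map_add]
    linear_combination h2
  rw [this, AddChar.map_zero_eq_one, one_mul]

theorem apply_add_eq_zero_iff {n : ℕ} {ψ : State n} {v : Bits n} (hv : v ∈ pauliShifts ψ)
    (x : Bits n) : ψ (x + v) = 0 ↔ ψ x = 0 := by
  obtain ⟨k, b, h⟩ := hv
  rw [h, mul_eq_zero, or_iff_right (iChar_ne_zero _)]

/-- Cutting `ψ` down to the coset of `pauliShifts ψ` through `x` preserves invariance under every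
Pauli operator fixing `ψ`. So the truncation is a multiple of `ψ`, by 1 since they agree at `x`, and
nothing was cut off. -/
theorem IsStabilizerState.mem_support_iff {n : ℕ} {ψ : State n} (hψ : IsStabilizerState ψ)
    {x : Bits n} (hx : x ∈ Function.support ψ) (y : Bits n) :
    y ∈ Function.support ψ ↔ x + y ∈ pauliShifts ψ := by
  classical
  constructor
  · intro hy
    let φ : State n := fun y => if x + y ∈ pauliShifts ψ then ψ y else 0
    obtain ⟨c, hc⟩ := hψ.2 φ (by
      intro k a b h
      have ha := mem_pauliShifts_of_pauli h
      funext z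
      have hz := congrFun h z
      rw [pauli_apply] at hz ⊢
      have : x + (z + a) ∈ pauliShifts ψ ↔ x + z ∈ pauliShifts ψ := by
        rw [← add_assoc]; exact AddSubgroup.add_mem_cancel_right _ ha
      by_cases hxz : x + z ∈ pauliShifts ψ
      · simpa [φ, this, hxz] using hz
      · simp [φ, this, hxz])
    have hcx := congrFun hc x
    have hφx : φ x = ψ x := by simp [φ, bits_add_self]
    rw [hφx, Pi.smul_apply, smul_eq_mul] at hcx
    have hc1 : c = 1 := (mul_right_cancel₀ hx (by rw [one_mul]; exact hcx)).symm
    by_contra hxy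
    have hcy := congrFun hc y
    rw [hc1, one_smul] at hcy
    exact hy (by rw [← hcy]; simp [φ, hxy])
  · intro h
    rw [Function.mem_support, ← bits_add_add_cancel x y, Ne, apply_add_eq_zero_iff h]
    exact hx

theorem IsStabilizerState.support_nonempty {n : ℕ} {ψ : State n} (hψ : IsStabilizerState ψ) :
    (Function.support ψ).Nonempty :=
  Function.support_nonempty_iff.2 hψ.1

theorem IsStabilizerState.add_add_mem_support {n : ℕ} {ψ : State n} (hψ : IsStabilizerState ψ)
    {x y z : Bits n} (hx : x ∈ Function.support ψ) (hy : y ∈ Function.support ψ)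
    (hz : z ∈ Function.support ψ) : x + y + z ∈ Function.support ψ := by
  rw [add_comm, hψ.mem_support_iff hz, bits_add_add_cancel, ← hψ.mem_support_iff hx]
  exact hy

theorem IsStabilizerState.exists_affineSubspace {n : ℕ} {ψ : State n} (hψ : IsStabilizerState ψ) :
    ∃ A : AffineSubspace (ZMod 2) (Bits n), (A : Set (Bits n)) = Function.support ψ := by
  obtain ⟨x, hx⟩ := hψ.support_nonempty
  refine ⟨AffineSubspace.mk' x (AddSubgroup.toZModSubmodule 2 (pauliShifts ψ)), ?_⟩
  ext y
  rw [SetLike.mem_coe, AffineSubspace.mem_mk', hψ.mem_support_iff hx,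
    AddSubgroup.mem_toZModSubmodule, vsub_eq_sub, sub_eq_add_neg,
    neg_eq_of_add_eq_zero_left (bits_add_self x), add_comm]

theorem IsFreeVariableSet.eq_of_eqOn {n : ℕ} {A : Set (Bits n)} {F : Finset (Fin n)}
    (hF : IsFreeVariableSet A F) {x y : Bits n} (hx : x ∈ A) (hy : y ∈ A)
    (h : ∀ j ∈ F, x j = y j) : x = y :=
  (hF fun j => y j).unique ⟨hx, fun j => h j j.2⟩ ⟨hy, fun _ => rfl⟩

theorem IsFreeVariableSet.exists_mem {n : ℕ} {A : Set (Bits n)} {F : Finset (Fin n)}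
    (hF : IsFreeVariableSet A F) (y : Bits n) : ∃ x ∈ A, ∀ j ∈ F, x j = y j := by
  obtain ⟨x, ⟨hx, hxy⟩, -⟩ := hF fun j => y j
  exact ⟨x, hx, fun j hj => hxy ⟨j, hj⟩⟩

theorem IsFreeVariableSet.eq_of_subset {n : ℕ} {A B : Set (Bits n)} {F : Finset (Fin n)}
    (hA : IsFreeVariableSet A F) (hB : IsFreeVariableSet B F) (h : A ⊆ B) : A = B := by
  refine h.antisymm fun x hx => ?_
  obtain ⟨y, hy, hyx⟩ := hA.exists_mem x
  rwa [← hB.eq_of_eqOn (h hy) hx hyx]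

/-- `hA` only puts the support inside the affine set; equality follows since both are graphs over
the coordinates in `F`. -/
theorem eq_smul_phaseState {n : ℕ} {ψ : State n} {F : Finset (Fin n)}
    (hF : IsFreeVariableSet (Function.support ψ) F) {a : Fin n → ZMod 2}
    {c : Fin n → Fin n → ZMod 2} {r : Fin n → ZMod 4} {s : Fin n → Fin n → ZMod 2} {z : ℂ}
    (hA : ∀ k, k ∉ F → ∀ x ∈ Function.support ψ, x k = a k + ∑ j ∈ F, c k j * x j)
    (hz : ∀ x ∈ Function.support ψ, ψ x = z * Complex.I ^ (phasePoly F r s x).val) :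
    ψ = z • phaseState F a c r s := by
  have hsupp := hF.eq_of_subset (isFreeVariableSet_affineSet F a c) fun x hx k hk => hA k hk x hx
  funext x
  by_cases hx : x ∈ Function.support ψ
  · rw [hz x hx, ← iChar_apply]
    simp [phaseState, hsupp ▸ hx]
  · have hx' : x ∉ affineSet F a c := hsupp ▸ hx
    simpa [phaseState, hx'] using hx

/-- Take the support point `x₀` vanishing on `F` and shifts `v j` dual to the free coordinates. Each
shift multiplies the amplitude at `x` by `i` to the power `k j + 2 (b j · x)`, so adding shifts one
at a time collects the phase polynomial. -/
theorem IsStabilizerState.exists_eq_smul_phaseState {n : ℕ} {ψ : State n}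
    (hψ : IsStabilizerState ψ) {F : Finset (Fin n)}
    (hF : IsFreeVariableSet (Function.support ψ) F) :
    ∃ (a : Fin n → ZMod 2) (c : Fin n → Fin n → ZMod 2) (r : Fin n → ZMod 4)
      (s : Fin n → Fin n → ZMod 2), ∃ z : ℂ, z ≠ 0 ∧ ψ = z • phaseState F a c r s := by
  obtain ⟨x₀, hx₀, hx₀F⟩ := hF.exists_mem 0
  have hbasis : ∀ k : Fin n, ∃ v ∈ pauliShifts ψ, ∀ j ∈ F, v j = if j = k then 1 else 0 := by
    intro k
    obtain ⟨x, hx, hxF⟩ := hF.exists_mem fun j => if j = k then 1 else 0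
    refine ⟨x₀ + x, (hψ.mem_support_iff hx₀ x).1 hx, fun j hj => ?_⟩
    rw [Pi.add_apply, hx₀F j hj, hxF j hj]
    simp
  choose v hv hvF using hbasis
  choose k b hkb using hv
  have hmem : ∀ y : Bits n, x₀ + ∑ j ∈ F, y j • v j ∈ Function.support ψ := by
    intro y
    rw [hψ.mem_support_iff hx₀, bits_add_add_cancel]
    refine AddSubgroup.sum_mem _ fun j _ => ?_
    rcases two_cases (y j) with h | h
    · rw [h, zero_smul]; exact zero_mem _
    · rw [h, one_smul]; exact ⟨k j, b j, hkb j⟩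
  have hcoord : ∀ (y : Bits n), ∀ i ∈ F, (x₀ + ∑ j ∈ F, y j • v j) i = y i := by
    intro y i hi
    have : ∀ j, v j i = if i = j then 1 else 0 := fun j => hvF j i hi
    simp [hx₀F i hi, this, hi]
  have hdecomp : ∀ x ∈ Function.support ψ, x = x₀ + ∑ j ∈ F, x j • v j := fun x hx =>
    hF.eq_of_eqOn hx (hmem x) fun j hj => (hcoord x j hj).symm
  -- `r j` is the exponent gained by shifting from `x₀` itself; `s j l` is the extra sign of shift
  -- `l` when `v j` has already been added.
  let r : Fin n → ZMod 4 := fun j => k j + double (∑ i, b j i * x₀ i)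
  let s : Fin n → Fin n → ZMod 2 := fun j l => ∑ i, b l i * v j i
  have hphase : ∀ T : Finset (Fin n), ψ (x₀ + ∑ j ∈ T, v j) =
      ψ x₀ * iChar (∑ j ∈ T, r j + ∑ j ∈ T, ∑ l ∈ T with j < l, double (s j l)) := by
    intro T
    -- Adding the largest index last makes the new cross terms exactly the pairs `j < l`.
    induction T using Finset.induction_on_max with
    | empty => simp
    | insert l T hl ih =>
      have hlT : l ∉ T := fun h => lt_irrefl _ (hl l h)
      have hsum : ∑ j ∈ insert l T, ∑ m ∈ insert l T with j < m, double (s j m) =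
          (∑ j ∈ T, ∑ m ∈ T with j < m, double (s j m)) + ∑ j ∈ T, double (s j l) := by
        rw [Finset.sum_insert hlT, Finset.sum_eq_zero, zero_add, ← Finset.sum_add_distrib]
        · refine Finset.sum_congr rfl fun j hj => ?_
          rw [Finset.filter_insert, if_pos (hl j hj), Finset.sum_insert (by simp [hlT]), add_comm]
        · intro m hm
          rw [Finset.mem_filter, Finset.mem_insert] at hm
          rcases hm with ⟨rfl | h, h'⟩
          · exact absurd h' (lt_irrefl _)
          · exact absurd (hl m h) h'.asymm
      rw [Finset.sum_insert hlT, add_comm (v l), ← add_assoc, hkb, ih, mul_left_comm,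
        ← AddChar.map_add_eq_mul, hsum, Finset.sum_insert hlT]
      congr 2
      have : double (∑ i, b l i * (x₀ + ∑ j ∈ T, v j) i) =
          double (∑ i, b l i * x₀ i) + ∑ j ∈ T, double (s j l) := by
        rw [← map_sum, ← map_add, Finset.sum_comm]
        simp only [Pi.add_apply, Finset.sum_apply, mul_add, Finset.mul_sum,
          Finset.sum_add_distrib]
      rw [this]
      simp only [r]
      abel
  refine ⟨x₀, fun m j => v j m, r, s, ψ x₀, hx₀, eq_smul_phaseState hF ?_ ?_⟩
  · intro m _ x hx
    conv_lhs => rw [hdecomp x hx]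
    simp [mul_comm]
  · intro x hx
    have hT : ∀ j ∈ F, x j = if j ∈ F.filter (fun j => x j = 1) then 1 else 0 := by
      intro j hj
      rcases two_cases (x j) with h | h <;> simp [h, hj]
    rw [← iChar_apply, phasePoly_indicator (Finset.filter_subset _ _) r s hT, ← hphase]
    conv_lhs => rw [hdecomp x hx]
    congr 2
    rw [Finset.sum_filter]
    refine Finset.sum_congr rfl fun j _ => ?_
    rcases two_cases (x j) with h | h <;> simp [h]

/-! ### The canonical set of free variables -/

theorem mem_canonicalFreeAux_succ {n : ℕ} {A : Set (Bits n)} {m : ℕ} {j : Fin n} :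
    j ∈ canonicalFreeAux A (m + 1) ↔ j ∈ canonicalFreeAux A m ∨
      j.val = m ∧ ¬ IsFixedGiven A (canonicalFreeAux A m) j := by
  simp [canonicalFreeAux]

theorem eq_of_eqOn_canonicalFreeAux {n : ℕ} {A : Set (Bits n)} {m : ℕ} {x y : Bits n}
    (hx : x ∈ A) (hy : y ∈ A) (h : ∀ j ∈ canonicalFreeAux A m, x j = y j) (j : Fin n)
    (hj : j.val < m) : x j = y j := by
  induction m with
  | zero => exact absurd hj (Nat.not_lt_zero _)
  | succ m ih =>
    have h' : ∀ j ∈ canonicalFreeAux A m, x j = y j := fun j hj =>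
      h j (mem_canonicalFreeAux_succ.2 (.inl hj))
    rcases Nat.lt_succ_iff_lt_or_eq.1 hj with hlt | heq
    · exact ih h' hlt
    · by_cases hfix : IsFixedGiven A (canonicalFreeAux A m) j
      · exact hfix x hx y hy h'
      · exact h j (mem_canonicalFreeAux_succ.2 (.inr ⟨heq, hfix⟩))

/-- A variable declared free has two witnesses `u`, `w` in `A` that agree on the earlier free
variables and differ at it. Adding `u + w` corrects its value without disturbing the earlier ones.
-/
theorem exists_mem_eqOn_canonicalFreeAux {n : ℕ} {A : Set (Bits n)} (hne : A.Nonempty)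
    (hA : ∀ x ∈ A, ∀ y ∈ A, ∀ z ∈ A, x + y + z ∈ A) (y : Bits n) (m : ℕ) :
    ∃ x ∈ A, ∀ j ∈ canonicalFreeAux A m, x j = y j := by
  induction m with
  | zero =>
    obtain ⟨x, hx⟩ := hne
    exact ⟨x, hx, fun j hj => by simp [canonicalFreeAux] at hj⟩
  | succ m ih =>
    obtain ⟨x, hx, hxy⟩ := ih
    by_cases hm : ∀ j ∈ canonicalFreeAux A (m + 1), x j = y j
    · exact ⟨x, hx, hm⟩
    · push Not at hm
      obtain ⟨j, hj, hxj⟩ := hm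
      rcases mem_canonicalFreeAux_succ.1 hj with hj | ⟨hjm, hfix⟩
      · exact absurd (hxy j hj) hxj
      · unfold IsFixedGiven at hfix
        push Not at hfix
        obtain ⟨u, hu, w, hw, huw, hne⟩ := hfix
        refine ⟨x + u + w, hA x hx u hu w hw, fun i hi => ?_⟩
        simp only [Pi.add_apply]
        rcases mem_canonicalFreeAux_succ.1 hi with hi | ⟨him, -⟩
        · rw [hxy i hi, huw i hi, add_assoc, CharTwo.add_self_eq_zero, add_zero]
        · obtain rfl : i = j := Fin.ext (him.trans hjm.symm)
          generalize x i = p, y i = q, u i = t, w i = o at *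
          revert p q t o; decide

theorem isFreeVariableSet_canonicalFree {n : ℕ} {A : Set (Bits n)} (hne : A.Nonempty)
    (hA : ∀ x ∈ A, ∀ y ∈ A, ∀ z ∈ A, x + y + z ∈ A) :
    IsFreeVariableSet A (canonicalFree A) := by
  intro y
  obtain ⟨x, hx, hxy⟩ := exists_mem_eqOn_canonicalFreeAux hne hA
    (fun j => if h : j ∈ canonicalFree A then y ⟨j, h⟩ else 0) n
  have hxy' : ∀ j : canonicalFree A, x j = y j := fun j => by
    rw [hxy j j.2]; simp
  exact ⟨x, ⟨hx, hxy'⟩, fun x' hx' => funext fun j =>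
    eq_of_eqOn_canonicalFreeAux (m := n) hx'.1 hx
      (fun j hj => (hx'.2 ⟨j, hj⟩).trans (hxy' ⟨j, hj⟩).symm) j j.2⟩

/-! ### The interpretation of a diagram as a sum over the labels of its spiders -/

/-- The scalar of an edge between spiders with the given colours and labels. -/
noncomputable def edgeFactor (h : Bool) (k : Colour) (s : ZMod 2) (k' : Colour) (s' : ZMod 2) : ℂ :=
  ∑ p : ZMod 2 × ZMod 2, legEntry k s p.1 * legEntry k' s' p.2 *
    (if h = true then hadamardEntry p.1 p.2 else wireEntry p.1 p.2)

theorem hadamardEntry_comm (a b : ZMod 2) : hadamardEntry a b = hadamardEntry b a := by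
  rw [hadamardEntry, hadamardEntry, mul_comm a b]

theorem wireEntry_comm (a b : ZMod 2) : wireEntry a b = wireEntry b a := by
  simp only [wireEntry, eq_comm]

theorem edgeFactor_comm (h : Bool) (k : Colour) (s : ZMod 2) (k' : Colour) (s' : ZMod 2) :
    edgeFactor h k s k' s' = edgeFactor h k' s' k s := by
  unfold edgeFactor
  rw [← Equiv.sum_comp (Equiv.prodComm (ZMod 2) (ZMod 2))]
  refine Finset.sum_congr rfl fun p _ => ?_
  simp only [Equiv.prodComm_apply, Prod.fst_swap, Prod.snd_swap]
  rw [hadamardEntry_comm, wireEntry_comm, mul_comm (legEntry k s p.2)]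

theorem sum_zmod_two {M : Type*} [AddCommMonoid M] (f : ZMod 2 → M) :
    ∑ s, f s = f 0 + f 1 :=
  Fin.sum_univ_two f

theorem edgeFactor_hadamard (s s' : ZMod 2) :
    edgeFactor true Colour.green s Colour.green s' = hadamardEntry s s' := by
  simp [edgeFactor, legEntry, wireEntry, Fintype.sum_prod_type]

theorem edgeFactor_plain (s s' : ZMod 2) :
    edgeFactor false Colour.green s Colour.red s' = hadamardEntry s s' := by
  simp [edgeFactor, legEntry, wireEntry, Fintype.sum_prod_type]

open Classical in
theorem prod_prod_fiber {ι κ : Type*} [Fintype ι] [Fintype κ] (g : ι → κ) (f : κ → ι → ℂ) :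
    ∏ v, ∏ i with g i = v, f v i = ∏ i, f (g i) i := by
  rw [← Finset.prod_fiberwise Finset.univ g]
  refine Finset.prod_congr rfl fun v _ => Finset.prod_congr rfl fun i hi => ?_
  rw [(Finset.mem_filter.1 hi).2]

theorem prod_sum_univ {ι κ : Type*} [Fintype ι] [DecidableEq ι] [Fintype κ] (f : ι → κ → ℂ) :
    ∏ i, ∑ s, f i s = ∑ t : ι → κ, ∏ i, f i (t i) := by
  rw [Finset.prod_univ_sum, Fintype.piFinset_univ]

/-- Expanding the two-term spider tensors gives a sum over labellings `t`. For fixed `t`, each pair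
of end bits occurs in one edge only, so the sum over `σ` factors over the edges. -/
theorem ZXDiagram.interp_eq {n : ℕ} (D : ZXDiagram n) [DecidableEq D.Spider] (x : Bits n) :
    D.interp x = ∑ t : D.Spider → ZMod 2,
      (∏ v, if t v = 0 then 1 else ((D.phase v).toCircle : ℂ)) *
      (∏ j, legEntry (D.colour (D.out j)) (t (D.out j)) (x j)) *
      ∏ e, edgeFactor (D.hadamard e) (D.colour (D.src e)) (t (D.src e))
        (D.colour (D.tgt e)) (t (D.tgt e)) := by
  classical
  simp only [interp, spiderTensor, prod_sum_univ, Finset.sum_mul]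
  rw [Finset.sum_comm]
  refine Finset.sum_congr rfl fun t _ => ?_
  simp only [edgeFactor, prod_sum_univ, Finset.mul_sum]
  refine Finset.sum_congr rfl fun σ _ => ?_
  simp only [Finset.prod_mul_distrib, edgeTensor]
  rw [prod_prod_fiber D.src fun v e => legEntry (D.colour v) (t v) (σ e).1,
    prod_prod_fiber D.tgt fun v e => legEntry (D.colour v) (t v) (σ e).2,
    prod_prod_fiber D.out fun v j => legEntry (D.colour v) (t v) (x j)]
  ring

theorem ZXDiagram.Iso.interp_eq {n : ℕ} {D D' : ZXDiagram n} (h : D.Iso D') :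
    D.interp = D'.interp := by
  classical
  obtain ⟨f, g, hc, hp, he, hh, ho⟩ := h
  funext x
  rw [D.interp_eq, D'.interp_eq, ← Equiv.sum_comp (f.arrowCongr (Equiv.refl (ZMod 2)))]
  refine Finset.sum_congr rfl fun t _ => ?_
  have ht : ∀ v, (f.arrowCongr (Equiv.refl (ZMod 2))) t (f v) = t v := fun v => by simp
  congr 1
  · congr 1
    · rw [← Equiv.prod_comp f]
      exact Finset.prod_congr rfl fun v _ => by rw [ht, hp]
    · exact Finset.prod_congr rfl fun j _ => by rw [ho, ht, hc]
  · rw [← Equiv.prod_comp g]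
    refine Finset.prod_congr rfl fun e _ => ?_
    rcases Sym2.eq_iff.1 (he e) with ⟨h1, h2⟩ | ⟨h1, h2⟩
    · rw [h1, h2, ht, ht, hc, hc, hh]
    · rw [h1, h2, ht, ht, hc, hc, hh, edgeFactor_comm]

/-! ### The diagram with given coefficients -/

/-- The colour of the spider at output `j`. -/
def coeffColour {n : ℕ} (F : Finset (Fin n)) (j : Fin n) : Colour :=
  if j ∈ F then Colour.green else Colour.red

/-- The phase of the spider at output `j`. -/
noncomputable def coeffPhase {n : ℕ} (F : Finset (Fin n)) (a : Fin n → ZMod 2)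
    (r : Fin n → ZMod 4) (j : Fin n) : Real.Angle :=
  if j ∈ F then (((r j).val * (Real.pi / 2) : ℝ) : Real.Angle)
    else (((a j).val * Real.pi : ℝ) : Real.Angle)

/-- The edges of the diagram with the given coefficients. -/
abbrev CoeffEdge {n : ℕ} (F : Finset (Fin n)) (c s : Fin n → Fin n → ZMod 2) : Type :=
  {e : Fin n × Fin n // e.1 ∈ F ∧
    (e.2 ∉ F ∧ c e.2 e.1 = 1 ∨ e.2 ∈ F ∧ e.1 < e.2 ∧ s e.1 e.2 = 1)}

/-- The phase-polynomial form diagram with the given coefficients. -/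
noncomputable def coeffDiagram {n : ℕ} (F : Finset (Fin n)) (a : Fin n → ZMod 2)
    (c : Fin n → Fin n → ZMod 2) (r : Fin n → ZMod 4) (s : Fin n → Fin n → ZMod 2) :
    ZXDiagram n where
  Spider := Fin n
  Edge := CoeffEdge F c s
  fintypeSpider := inferInstance
  fintypeEdge := inferInstance
  colour := coeffColour F
  phase := coeffPhase F a r
  src e := e.1.1
  tgt e := e.1.2
  hadamard e := decide (e.1.2 ∈ F)
  out j := j

theorem toCircle_mul_pi_div_two (m : ℕ) :
    (((m * (Real.pi / 2) : ℝ) : Real.Angle).toCircle : ℂ) = Complex.I ^ m := by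
  rw [Real.Angle.toCircle_coe, Circle.coe_exp]
  conv_rhs => rw [← Complex.exp_pi_div_two_mul_I, ← Complex.exp_nat_mul]
  congr 1; push_cast; ring

theorem toCircle_mul_pi (m : ℕ) :
    (((m * Real.pi : ℝ) : Real.Angle).toCircle : ℂ) = (-1) ^ m := by
  rw [Real.Angle.toCircle_coe, Circle.coe_exp, ← Complex.exp_pi_mul_I, ← Complex.exp_nat_mul]
  congr 1; push_cast; ring

theorem hadamardEntry_eq (a b : ZMod 2) :
    hadamardEntry a b = 1 / (Real.sqrt 2 : ℂ) * iChar (double (a * b)) := by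
  rw [iChar_double]; rfl

theorem iChar_sum {ι : Type*} (S : Finset ι) (f : ι → ZMod 4) :
    iChar (∑ i ∈ S, f i) = ∏ i ∈ S, iChar (f i) := by
  classical
  induction S using Finset.induction_on with
  | empty => simp
  | insert i S hi ih =>
    rw [Finset.sum_insert hi, Finset.prod_insert hi, AddChar.map_add_eq_mul, ih]

theorem one_div_sqrt_two_ne_zero : (1 / (Real.sqrt 2 : ℂ)) ≠ 0 := by
  simp

section coeffDiagram

variable {n : ℕ} (F : Finset (Fin n)) (a : Fin n → ZMod 2) (c : Fin n → Fin n → ZMod 2)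
  (r : Fin n → ZMod 4) (s : Fin n → Fin n → ZMod 2)

/-- Both kinds of edge contribute a Hadamard entry: a plain edge joins the computational basis of a
green spider to the `±` basis of a red one. -/
theorem prod_edgeFactor_coeff (t : Bits n) :
    ∏ e : CoeffEdge F c s, edgeFactor (decide (e.1.2 ∈ F)) (coeffColour F e.1.1) (t e.1.1)
        (coeffColour F e.1.2) (t e.1.2) =
      (1 / (Real.sqrt 2 : ℂ)) ^ Fintype.card (CoeffEdge F c s) *
        iChar (∑ j ∈ F, (∑ k ∈ Fᶜ, double (c k j * t j * t k) +
          ∑ k ∈ F with j < k, double (s j k * t j * t k))) := by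
  have h1 : ∀ e : CoeffEdge F c s, edgeFactor (decide (e.1.2 ∈ F)) (coeffColour F e.1.1) (t e.1.1)
        (coeffColour F e.1.2) (t e.1.2) =
      1 / (Real.sqrt 2 : ℂ) * iChar (double (t e.1.1 * t e.1.2)) := by
    rintro ⟨⟨j, k⟩, hj, hk⟩
    rw [← hadamardEntry_eq]
    dsimp only at hj hk ⊢
    unfold coeffColour
    rcases hk with hk | hk
    · simp only [hj, hk.1, decide_false, if_true, if_false, edgeFactor_plain]
    · simp only [hj, hk.1, decide_true, if_true, edgeFactor_hadamard]
  rw [Finset.prod_congr rfl fun e _ => h1 e, Finset.prod_mul_distrib, Finset.prod_const,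
    Finset.card_univ, ← iChar_sum]
  congr 2
  have h2 : ∑ e : Fin n × Fin n with e.1 ∈ F ∧
      (e.2 ∉ F ∧ c e.2 e.1 = 1 ∨ e.2 ∈ F ∧ e.1 < e.2 ∧ s e.1 e.2 = 1), double (t e.1 * t e.2) =
      ∑ e : CoeffEdge F c s, double (t e.1.1 * t e.1.2) :=
    Finset.sum_subtype _ (fun e => by simp) _
  refine h2.symm.trans ?_
  rw [Finset.sum_filter, Fintype.sum_prod_type, ← Finset.sum_add_sum_compl F,
    Finset.sum_eq_zero (s := Fᶜ), add_zero]
  · refine Finset.sum_congr rfl fun j hj => ?_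
    rw [← Finset.sum_add_sum_compl F, add_comm]
    congr 1
    · refine Finset.sum_congr rfl fun k hk => ?_
      rw [Finset.mem_compl] at hk
      rcases two_cases (c k j) with h | h <;> simp [hj, hk, h]
    · rw [Finset.sum_filter]
      refine Finset.sum_congr rfl fun k hk => ?_
      rcases two_cases (s j k) with h | h <;> simp [hj, hk, h]
  · intro j hj
    rw [Finset.mem_compl] at hj
    simp [hj]

theorem prod_phase_coeff (t : Bits n) :
    (∏ v : Fin n, if t v = 0 then (1 : ℂ) else
        ((coeffPhase F a r v).toCircle : ℂ)) =
      iChar (∑ j ∈ F, r j * ((t j).val : ZMod 4) + ∑ k ∈ Fᶜ, double (a k * t k)) := by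
  rw [AddChar.map_add_eq_mul, iChar_sum, iChar_sum,
    ← Finset.prod_mul_prod_compl F]
  congr 1
  · refine Finset.prod_congr rfl fun j hj => ?_
    rcases two_cases (t j) with h | h
    · simp [h]
    · rw [h, ZMod.val_one, Nat.cast_one, mul_one, if_neg one_ne_zero, coeffPhase, if_pos hj,
        toCircle_mul_pi_div_two, iChar_apply]
  · refine Finset.prod_congr rfl fun k hk => ?_
    rw [Finset.mem_compl] at hk
    rcases two_cases (t k) with h | h
    · simp [h]
    · rw [iChar_double, ← toCircle_mul_pi]
      simp [h, coeffPhase, hk]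

theorem prod_leg_coeff {x t : Bits n} (h : ∀ j ∈ F, x j = t j) :
    (∏ j : Fin n, legEntry (coeffColour F j) (t j) (x j)) =
      (1 / (Real.sqrt 2 : ℂ)) ^ Fᶜ.card * iChar (∑ k ∈ Fᶜ, double (x k * t k)) := by
  rw [← Finset.prod_mul_prod_compl F, Finset.prod_eq_one (s := F), one_mul,
    iChar_sum, ← Finset.prod_const, ← Finset.prod_mul_distrib]
  · refine Finset.prod_congr rfl fun k hk => ?_
    rw [Finset.mem_compl] at hk
    simp only [coeffColour, hk, if_false, legEntry, hadamardEntry_eq]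
  · intro j hj
    simp [coeffColour, hj, legEntry, wireEntry, h]

theorem prod_leg_coeff_eq_zero {x t : Bits n} {j : Fin n} (hj : j ∈ F) (h : x j ≠ t j) :
    (∏ j : Fin n, legEntry (coeffColour F j) (t j) (x j)) = 0 := by
  refine Finset.prod_eq_zero (Finset.mem_univ j) ?_
  simp [coeffColour, hj, legEntry, wireEntry, h]

/-- Green output legs force `t = x` on `F`. The label of each red spider then enters the exponent
linearly, multiplied by the defect of its affine equation, so the summand factors over the spiders.
-/
theorem interp_coeffDiagram_summand (x t : Bits n) :
    (∏ v : Fin n, if t v = 0 then (1 : ℂ) else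
        ((coeffPhase F a r v).toCircle : ℂ)) *
      (∏ j : Fin n, legEntry (coeffColour F j) (t j) (x j)) *
      ((1 / (Real.sqrt 2 : ℂ)) ^ Fintype.card (CoeffEdge F c s) *
        iChar (∑ j ∈ F, (∑ k ∈ Fᶜ, double (c k j * t j * t k) +
          ∑ k ∈ F with j < k, double (s j k * t j * t k)))) =
    (1 / (Real.sqrt 2 : ℂ)) ^ Fintype.card (CoeffEdge F c s) *
      (1 / (Real.sqrt 2 : ℂ)) ^ Fᶜ.card * iChar (phasePoly F r s x) *
      ∏ k, if k ∈ F then (if x k = t k then 1 else 0) else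
        iChar (double (t k * (a k + x k + ∑ j ∈ F, c k j * x j))) := by
  by_cases h : ∀ j ∈ F, x j = t j
  · rw [prod_phase_coeff, prod_leg_coeff F h,
      ← Finset.prod_mul_prod_compl F (fun k => if k ∈ F then _ else _),
      Finset.prod_eq_one (s := F) (fun j hj => by simp [hj, h]), one_mul,
      Finset.prod_congr rfl fun k hk => if_neg (Finset.mem_compl.1 hk), ← iChar_sum]
    have key : (∑ j ∈ F, r j * ((t j).val : ZMod 4) + ∑ k ∈ Fᶜ, double (a k * t k)) +
        ∑ k ∈ Fᶜ, double (x k * t k) + ∑ j ∈ F, (∑ k ∈ Fᶜ, double (c k j * t j * t k) +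
          ∑ k ∈ F with j < k, double (s j k * t j * t k)) = phasePoly F r s x +
        ∑ k ∈ Fᶜ, double (t k * (a k + x k + ∑ j ∈ F, c k j * x j)) := by
      rw [phasePoly_congr r s h, phasePoly_eq, Finset.sum_add_distrib,
        Finset.sum_comm (s := F) (t := Fᶜ)]
      have : ∀ k, double (t k * (a k + x k + ∑ j ∈ F, c k j * x j)) = double (a k * t k) +
          double (x k * t k) + ∑ j ∈ F, double (c k j * t j * t k) := by
        intro k
        rw [← map_sum, ← map_add, ← map_add, ← Finset.sum_mul,
          Finset.sum_congr rfl fun j hj => by rw [h j hj]]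
        congr 1; ring
      simp only [this, Finset.sum_add_distrib]
      abel
    rw [mul_assoc _ (iChar (phasePoly F r s x)), ← AddChar.map_add_eq_mul, ← key]
    simp only [AddChar.map_add_eq_mul]
    ring
  · push Not at h
    obtain ⟨j, hj, hxt⟩ := h
    rw [prod_leg_coeff_eq_zero F hj hxt,
      Finset.prod_eq_zero (f := fun k => if k ∈ F then (if x k = t k then 1 else 0) else
        iChar (double (t k * (a k + x k + ∑ j ∈ F, c k j * x j)))) (Finset.mem_univ j)
        (by simp [hj, hxt])]
    simp

theorem interp_coeffDiagram :
    EqUpToScalar (coeffDiagram F a c r s).interp (phaseState F a c r s) := by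
  -- One `1/√2` per edge and per red output leg; summing over a red label gives 2 if its equation
  -- holds and `1 - 1 = 0` otherwise.
  refine ⟨(1 / (Real.sqrt 2 : ℂ)) ^ Fintype.card (CoeffEdge F c s) *
      (1 / (Real.sqrt 2 : ℂ)) ^ Fᶜ.card * ∏ k, if k ∈ F then 1 else 2, ?_, ?_⟩
  · refine mul_ne_zero (mul_ne_zero (pow_ne_zero _ one_div_sqrt_two_ne_zero)
      (pow_ne_zero _ one_div_sqrt_two_ne_zero)) (Finset.prod_ne_zero_iff.2 fun k _ => ?_)
    split_ifs <;> norm_num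
  funext x
  have h : (coeffDiagram F a c r s).interp x = ∑ t : Bits n,
      (∏ v, if t v = 0 then 1 else ((coeffPhase F a r v).toCircle : ℂ)) *
      (∏ j, legEntry (coeffColour F j) (t j) (x j)) *
      ∏ e : CoeffEdge F c s, edgeFactor (decide (e.1.2 ∈ F)) (coeffColour F e.1.1) (t e.1.1)
        (coeffColour F e.1.2) (t e.1.2) :=
    @ZXDiagram.interp_eq n (coeffDiagram F a c r s) (inferInstanceAs (DecidableEq (Fin n))) x
  simp only [prod_edgeFactor_coeff, interp_coeffDiagram_summand] at h
  rw [h, ← Finset.mul_sum, ← prod_sum_univ fun k b => if k ∈ F then (if x k = b then 1 else 0) else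
        iChar (double (b * (a k + x k + ∑ j ∈ F, c k j * x j)))]
  rw [Pi.smul_apply, smul_eq_mul]
  by_cases hx : x ∈ affineSet F a c
  · rw [phaseState, if_pos hx, mul_right_comm]
    congr 2
    refine Finset.prod_congr rfl fun k _ => ?_
    by_cases hk : k ∈ F
    · simp [hk]
    · have : a k + x k + ∑ j ∈ F, c k j * x j = 0 := by
        rw [add_right_comm, ← hx k hk, CharTwo.add_self_eq_zero]
      simp only [hk, if_false, this, mul_zero, map_zero, AddChar.map_zero_eq_one, sum_zmod_two]
      norm_num
  · rw [phaseState, if_neg hx, mul_zero]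
    simp only [affineSet, Set.mem_ofPred_eq, not_forall] at hx
    obtain ⟨k, hk, hxk⟩ := hx
    have : a k + x k + ∑ j ∈ F, c k j * x j = 1 := by
      refine (two_cases _).resolve_left fun h0 => hxk ?_
      rw [← CharTwo.add_eq_zero, ← h0]; ring
    rw [Finset.prod_eq_zero (Finset.mem_univ k), mul_zero]
    simp only [hk, if_false, this, sum_zmod_two, iChar_double, mul_one, ZMod.val_zero,
      ZMod.val_one, pow_zero, pow_one]
    norm_num

end coeffDiagram

/-! ### Coefficients of diagrams -/

/-- The phase-polynomial form diagram `D` has the given free variables and coefficients. -/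
structure HasCoeffs {n : ℕ} (D : ZXDiagram n) (F : Finset (Fin n)) (a : Fin n → ZMod 2)
    (c : Fin n → Fin n → ZMod 2) (r : Fin n → ZMod 4) (s : Fin n → Fin n → ZMod 2) : Prop where
  green : ∀ j, j ∈ F → D.colour (D.out j) = Colour.green
  red : ∀ k, k ∉ F → D.colour (D.out k) = Colour.red
  green_phase : ∀ j, j ∈ F →
    D.phase (D.out j) = (((r j).val * (Real.pi / 2) : ℝ) : Real.Angle)
  red_phase : ∀ k, k ∉ F → D.phase (D.out k) = (((a k).val * Real.pi : ℝ) : Real.Angle)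
  plain : ∀ j k, j ∈ F → k ∉ F → (D.PlainAdj (D.out j) (D.out k) ↔ c k j = 1)
  hadamard : ∀ j j', j ∈ F → j' ∈ F → j < j' →
    (D.HadamardAdj (D.out j) (D.out j') ↔ s j j' = 1)

theorem isTranslation_iff {n : ℕ} {D : ZXDiagram n} {ψ : State n} {F : Finset (Fin n)}
    (hF : IsFreeVariableSet (Function.support ψ) F) :
    D.IsTranslation ψ F ↔ D.IsPhasePolyForm ∧ ∃ a c r s, HasCoeffs D F a c r s ∧
      EqUpToScalar ψ (phaseState F a c r s) := by
  constructor
  · rintro ⟨hD, a, c, r, s, hA, ⟨z, hz, hψ⟩, h1, h2, h3, h4, h5, h6⟩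
    exact ⟨hD, a, c, r, s, ⟨h1, h2, h3, h4, h5, h6⟩, z, hz, eq_smul_phaseState hF hA hψ⟩
  · rintro ⟨hD, a, c, r, s, ⟨h1, h2, h3, h4, h5, h6⟩, z, hz, rfl⟩
    have hsupp : Function.support (z • phaseState F a c r s) = affineSet F a c := by
      rw [← support_phaseState F a c r s]
      exact Function.support_const_smul_of_ne_zero z _ hz
    rw [ZXDiagram.IsTranslation, hsupp]
    refine ⟨hD, a, c, r, s, fun k hk x hx => hx k hk, ⟨z, hz, fun x hx => ?_⟩,
      h1, h2, h3, h4, h5, h6⟩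
    simp [phaseState, hx, iChar_apply]

theorem ZXDiagram.PlainAdj.symm {n : ℕ} {D : ZXDiagram n} {v w : D.Spider} (h : D.PlainAdj v w) :
    D.PlainAdj w v := by
  obtain ⟨e, he, hs⟩ := h
  exact ⟨e, he, hs.trans Sym2.eq_swap⟩

theorem ZXDiagram.HadamardAdj.symm {n : ℕ} {D : ZXDiagram n} {v w : D.Spider}
    (h : D.HadamardAdj v w) : D.HadamardAdj w v := by
  obtain ⟨e, he, hs⟩ := h
  exact ⟨e, he, hs.trans Sym2.eq_swap⟩

theorem HasCoeffs.mem_iff {n : ℕ} {D : ZXDiagram n} {F : Finset (Fin n)} {a : Fin n → ZMod 2}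
    {c : Fin n → Fin n → ZMod 2} {r : Fin n → ZMod 4} {s : Fin n → Fin n → ZMod 2}
    (h : HasCoeffs D F a c r s) (j : Fin n) : j ∈ F ↔ D.colour (D.out j) = Colour.green := by
  refine ⟨h.green j, fun hg => ?_⟩
  by_contra hj
  rw [h.red j hj] at hg
  cases hg

/-! ### Uniqueness of the coefficients. -/

/-- The two families of coefficients agree wherever they are used by the translation with free
variables `F`. -/
structure CoeffsAgree {n : ℕ} (F : Finset (Fin n)) (a a' : Fin n → ZMod 2)
    (c c' : Fin n → Fin n → ZMod 2) (r r' : Fin n → ZMod 4) (s s' : Fin n → Fin n → ZMod 2) :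
    Prop where
  const : ∀ k ∉ F, a k = a' k
  linear : ∀ k ∉ F, ∀ j ∈ F, c k j = c' k j
  phase : ∀ j ∈ F, r j = r' j
  quadratic : ∀ j ∈ F, ∀ k ∈ F, j < k → s j k = s' j k

theorem CoeffsAgree.symm {n : ℕ} {F : Finset (Fin n)} {a a' : Fin n → ZMod 2}
    {c c' : Fin n → Fin n → ZMod 2} {r r' : Fin n → ZMod 4} {s s' : Fin n → Fin n → ZMod 2}
    (h : CoeffsAgree F a a' c c' r r' s s') : CoeffsAgree F a' a c' c r' r s' s :=
  ⟨fun k hk => (h.const k hk).symm, fun k hk j hj => (h.linear k hk j hj).symm,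
    fun j hj => (h.phase j hj).symm, fun j hj k hk hjk => (h.quadratic j hj k hk hjk).symm⟩

/-- Evaluate at the points whose free coordinates are the indicator of `T`: `T = ∅` yields the
scalar 1 and `a`, singletons yield `c` and `r`, pairs yield `s`. -/
theorem coeffsAgree_of_eqUpToScalar {n : ℕ} {F : Finset (Fin n)} {a a' : Fin n → ZMod 2}
    {c c' : Fin n → Fin n → ZMod 2} {r r' : Fin n → ZMod 4} {s s' : Fin n → Fin n → ZMod 2}
    (h : EqUpToScalar (phaseState F a c r s) (phaseState F a' c' r' s')) :
    CoeffsAgree F a a' c c' r r' s s' := by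
  obtain ⟨z, hz, h⟩ := h
  have hA : affineSet F a c = affineSet F a' c' := by
    rw [← support_phaseState F a c r s, ← support_phaseState F a' c' r' s', h]
    exact Function.support_const_smul_of_ne_zero z _ hz
  have hF := isFreeVariableSet_affineSet F a c
  have hex : ∀ T ⊆ F, ∃ x ∈ affineSet F a c, ∀ j ∈ F, x j = if j ∈ T then 1 else 0 := fun T _ =>
    hF.exists_mem fun j => if j ∈ T then 1 else 0
  have haff : ∀ T ⊆ F, ∀ k ∉ F, a k + ∑ j ∈ T, c k j = a' k + ∑ j ∈ T, c' k j := by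
    intro T hT k hk
    obtain ⟨x, hx, hxT⟩ := hex T hT
    have hx' : x ∈ affineSet F a' c' := hA ▸ hx
    have hsum : ∀ c : Fin n → Fin n → ZMod 2, ∑ j ∈ F, c k j * x j = ∑ j ∈ T, c k j := by
      intro c
      rw [Finset.sum_congr rfl fun j hj => by rw [hxT j hj]]
      simp [Finset.inter_eq_right.2 hT]
    rw [← hsum c, ← hsum c', ← hx k hk, ← hx' k hk]
  have hphase : ∀ T ⊆ F, iChar (∑ j ∈ T, r j + ∑ j ∈ T, ∑ k ∈ T with j < k, double (s j k)) =
      z * iChar (∑ j ∈ T, r' j + ∑ j ∈ T, ∑ k ∈ T with j < k, double (s' j k)) := by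
    intro T hT
    obtain ⟨x, hx, hxT⟩ := hex T hT
    have hx' : x ∈ affineSet F a' c' := hA ▸ hx
    have := congrFun h x
    simpa only [phaseState, Pi.smul_apply, smul_eq_mul, hx, hx', if_true,
      phasePoly_indicator hT _ _ hxT] using this
  have hz1 : z = 1 := by
    have := hphase ∅ (Finset.empty_subset F)
    simpa using this.symm
  have hconst : ∀ k ∉ F, a k = a' k := fun k hk => by
    simpa using haff ∅ (Finset.empty_subset F) k hk
  have hr : ∀ j ∈ F, r j = r' j := by
    intro j hj
    have := hphase {j} (Finset.singleton_subset_iff.2 hj)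
    rw [hz1, one_mul] at this
    simpa [Finset.filter_singleton] using iChar_injective this
  refine ⟨hconst, fun k hk j hj => ?_, hr, fun j hj k hk hjk => ?_⟩
  · have := haff {j} (Finset.singleton_subset_iff.2 hj) k hk
    simpa [hconst k hk] using this
  · have := hphase {j, k} (by simp [Finset.insert_subset_iff, hj, hk])
    rw [hz1, one_mul] at this
    have := iChar_injective this
    rw [Finset.sum_pair hjk.ne, Finset.sum_pair hjk.ne, Finset.sum_pair hjk.ne,
      Finset.sum_pair hjk.ne, hr j hj, hr k hk] at this
    apply double_injective
    simpa [Finset.filter_insert, Finset.filter_singleton, hjk, hjk.asymm] using this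

/-! ### Diagrams with the same coefficients -/

theorem HasCoeffs.exists_edge {n : ℕ} {D D' : ZXDiagram n} {F : Finset (Fin n)}
    {a a' : Fin n → ZMod 2} {c c' : Fin n → Fin n → ZMod 2} {r r' : Fin n → ZMod 4}
    {s s' : Fin n → Fin n → ZMod 2} (hD : D.IsPhasePolyForm) (h : HasCoeffs D F a c r s)
    (h' : HasCoeffs D' F a' c' r' s') (hagree : CoeffsAgree F a a' c c' r r' s s')
    (e : D.Edge) {i j : Fin n} (hi : D.src e = D.out i) (hj : D.tgt e = D.out j) :
    ∃ e', s(D'.src e', D'.tgt e') = s(D'.out i, D'.out j) ∧ D'.hadamard e' = D.hadamard e := by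
  have hij : i ≠ j := by
    rintro rfl
    exact hD.no_loops e (hi.trans hj.symm)
  have hs : s(D.src e, D.tgt e) = s(D.out i, D.out j) := by rw [hi, hj]
  by_cases he : D.hadamard e = true
  · obtain ⟨hci, hcj⟩ := hD.hadamard_edge e he
    rw [hi, ← h.mem_iff] at hci
    rw [hj, ← h.mem_iff] at hcj
    have hadj : D'.HadamardAdj (D'.out i) (D'.out j) := by
      have hadj : D.HadamardAdj (D.out i) (D.out j) := ⟨e, he, hs⟩
      rcases lt_or_gt_of_ne hij with hlt | hlt
      · rwa [h'.hadamard i j hci hcj hlt, ← hagree.quadratic i hci j hcj hlt,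
          ← h.hadamard i j hci hcj hlt]
      · refine ZXDiagram.HadamardAdj.symm ?_
        rw [h'.hadamard j i hcj hci hlt, ← hagree.quadratic j hcj i hci hlt,
          ← h.hadamard j i hcj hci hlt]
        exact hadj.symm
    obtain ⟨e', he', hs'⟩ := hadj
    exact ⟨e', hs', he'.trans he.symm⟩
  · rw [Bool.not_eq_true] at he
    have hne := hD.plain_edge e he
    rw [hi, hj] at hne
    have hadj : D'.PlainAdj (D'.out i) (D'.out j) := by
      have hadj : D.PlainAdj (D.out i) (D.out j) := ⟨e, he, hs⟩
      by_cases hci : i ∈ F <;> by_cases hcj : j ∈ F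
      · exact absurd ((h.green i hci).trans (h.green j hcj).symm) hne
      · rwa [h'.plain i j hci hcj, ← hagree.linear j hcj i hci, ← h.plain i j hci hcj]
      · refine ZXDiagram.PlainAdj.symm ?_
        rw [h'.plain j i hcj hci, ← hagree.linear i hci j hcj, ← h.plain j i hcj hci]
        exact hadj.symm
      · exact absurd ((h.red i hci).trans (h.red j hcj).symm) hne
    obtain ⟨e', he', hs'⟩ := hadj
    exact ⟨e', hs', he'.trans he.symm⟩

/-- Without parallel edges an edge is determined by its endpoints, so any choice of matching edges
is bijective. -/
theorem iso_of_exists_edge {n : ℕ} {D D' : ZXDiagram n} (hD : D.IsPhasePolyForm)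
    (hD' : D'.IsPhasePolyForm) (f : D.Spider ≃ D'.Spider)
    (hc : ∀ v, D'.colour (f v) = D.colour v) (hp : ∀ v, D'.phase (f v) = D.phase v)
    (ho : ∀ j, D'.out j = f (D.out j))
    (he : ∀ e, ∃ e', s(D'.src e', D'.tgt e') = s(f (D.src e), f (D.tgt e)) ∧
      D'.hadamard e' = D.hadamard e)
    (he' : ∀ e', ∃ e, s(D'.src e', D'.tgt e') = s(f (D.src e), f (D.tgt e))) :
    D.Iso D' := by
  choose g hg hgh using he
  have hbij : Function.Bijective g := by
    constructor
    · intro e₁ e₂ h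
      refine hD.no_parallel _ _ (Sym2.map.injective f.injective ?_)
      rw [Sym2.map_mk, Sym2.map_mk]
      exact (hg e₁).symm.trans ((congrArg (fun e => s(D'.src e, D'.tgt e)) h).trans (hg e₂))
    · intro e'
      obtain ⟨e, h⟩ := he' e'
      exact ⟨e, hD'.no_parallel _ _ ((hg e).trans h.symm)⟩
  exact ⟨f, Equiv.ofBijective g hbij, hc, hp, hg, hgh, ho⟩

theorem HasCoeffs.iso {n : ℕ} {D D' : ZXDiagram n} {F : Finset (Fin n)}
    {a a' : Fin n → ZMod 2} {c c' : Fin n → Fin n → ZMod 2} {r r' : Fin n → ZMod 4}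
    {s s' : Fin n → Fin n → ZMod 2} (hD : D.IsPhasePolyForm) (hD' : D'.IsPhasePolyForm)
    (h : HasCoeffs D F a c r s) (h' : HasCoeffs D' F a' c' r' s')
    (hagree : CoeffsAgree F a a' c c' r r' s s') : D.Iso D' := by
  let o := Equiv.ofBijective D.out hD.out_bijective
  let o' := Equiv.ofBijective D'.out hD'.out_bijective
  have hf : ∀ j, (o.symm.trans o') (D.out j) = D'.out j := fun j =>
    congrArg o' (o.symm_apply_apply j)
  refine iso_of_exists_edge hD hD' (o.symm.trans o') ?_ ?_ (fun j => (hf j).symm) ?_ ?_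
  · intro v
    obtain ⟨j, rfl⟩ := hD.out_bijective.2 v
    rw [hf]
    by_cases hj : j ∈ F
    · rw [h.green j hj, h'.green j hj]
    · rw [h.red j hj, h'.red j hj]
  · intro v
    obtain ⟨j, rfl⟩ := hD.out_bijective.2 v
    rw [hf]
    by_cases hj : j ∈ F
    · rw [h.green_phase j hj, h'.green_phase j hj, hagree.phase j hj]
    · rw [h.red_phase j hj, h'.red_phase j hj, hagree.const j hj]
  · intro e
    obtain ⟨i, hi⟩ := hD.out_bijective.2 (D.src e)
    obtain ⟨j, hj⟩ := hD.out_bijective.2 (D.tgt e)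
    obtain ⟨e', he', hh⟩ := h.exists_edge hD h' hagree e hi.symm hj.symm
    exact ⟨e', by rw [he', ← hi, ← hj, hf, hf], hh⟩
  · intro e'
    obtain ⟨i, hi⟩ := hD'.out_bijective.2 (D'.src e')
    obtain ⟨j, hj⟩ := hD'.out_bijective.2 (D'.tgt e')
    obtain ⟨e, he, -⟩ := h'.exists_edge hD' h hagree.symm e' hi.symm hj.symm
    refine ⟨e, ?_⟩
    have := congrArg (Sym2.map (o.symm.trans o')) he
    rw [Sym2.map_mk, Sym2.map_mk, hf, hf, hi, hj] at this
    exact this.symm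

theorem HasCoeffs.of_iso {n : ℕ} {D D' : ZXDiagram n} {F : Finset (Fin n)}
    {a : Fin n → ZMod 2} {c : Fin n → Fin n → ZMod 2} {r : Fin n → ZMod 4}
    {s : Fin n → Fin n → ZMod 2} (h : HasCoeffs D F a c r s) (hiso : D.Iso D') :
    HasCoeffs D' F a c r s := by
  obtain ⟨f, g, hc, hp, he, hh, ho⟩ := hiso
  have hadj : ∀ v w e, s(D'.src (g e), D'.tgt (g e)) = s(f v, f w) ↔
      s(D.src e, D.tgt e) = s(v, w) := by
    intro v w e
    rw [he, ← Sym2.map_mk, ← Sym2.map_mk, (Sym2.map.injective f.injective).eq_iff]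
  have hplain : ∀ v w, D'.PlainAdj (f v) (f w) ↔ D.PlainAdj v w := by
    intro v w
    exact (g.exists_congr fun e => by rw [hh, hadj]).symm
  have hhad : ∀ v w, D'.HadamardAdj (f v) (f w) ↔ D.HadamardAdj v w := by
    intro v w
    exact (g.exists_congr fun e => by rw [hh, hadj]).symm
  refine ⟨fun j hj => ?_, fun j hj => ?_, fun j hj => ?_, fun j hj => ?_, fun j k hj hk => ?_,
    fun j k hj hk hjk => ?_⟩
  · rw [ho, hc, h.green j hj]
  · rw [ho, hc, h.red j hj]
  · rw [ho, hp, h.green_phase j hj]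
  · rw [ho, hp, h.red_phase j hj]
  · rw [ho, ho, hplain, h.plain j k hj hk]
  · rw [ho, ho, hhad, h.hadamard j k hj hk hjk]

/-! ### Existence of diagrams and of coefficients -/

section coeffDiagram

variable {n : ℕ} (F : Finset (Fin n)) (a : Fin n → ZMod 2) (c : Fin n → Fin n → ZMod 2)
  (r : Fin n → ZMod 4) (s : Fin n → Fin n → ZMod 2)

theorem isPhasePolyForm_coeffDiagram : (coeffDiagram F a c r s).IsPhasePolyForm where
  out_bijective := Function.bijective_id
  red_phase := by
    intro (v : Fin n) (hv : coeffColour F v = Colour.red)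
    show coeffPhase F a r v = 0 ∨ coeffPhase F a r v = _
    have hvF : v ∉ F := fun h => by simp [coeffColour, h] at hv
    rcases two_cases (a v) with h | h <;> simp [coeffPhase, hvF, h, ZMod.val_one]
  green_phase := by
    intro (v : Fin n) (hv : coeffColour F v = Colour.green)
    show ∃ m : ℤ, coeffPhase F a r v = _
    have hvF : v ∈ F := by
      by_contra h
      simp [coeffColour, h] at hv
    exact ⟨((r v).val : ℕ), by simp only [coeffPhase, hvF, if_true, Int.cast_natCast]⟩
  plain_edge := by
    rintro ⟨⟨j, k⟩, hj, hk⟩ (he : decide (k ∈ F) = false)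
    show coeffColour F j ≠ coeffColour F k
    rw [decide_eq_false_iff_not] at he
    simp only at hj
    simp [coeffColour, hj, he]
  hadamard_edge := by
    rintro ⟨⟨j, k⟩, hj, hk⟩ (he : decide (k ∈ F) = true)
    show coeffColour F j = _ ∧ coeffColour F k = _
    rw [decide_eq_true_eq] at he
    simp only at hj
    simp [coeffColour, hj, he]
  no_loops := by
    rintro ⟨⟨j, k⟩, hj, hk⟩ (rfl : j = k)
    rcases hk with ⟨hk, -⟩ | ⟨-, hk, -⟩
    · exact hk hj
    · exact lt_irrefl _ hk
  no_parallel := by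
    rintro ⟨⟨j, k⟩, hj, hk⟩ ⟨⟨j', k'⟩, hj', hk'⟩ (h : s(j, k) = s(j', k'))
    apply Subtype.ext
    simp only at hj hk hj' hk' ⊢
    rcases Sym2.eq_iff.1 h with ⟨rfl, rfl⟩ | ⟨rfl, rfl⟩
    · rfl
    · rcases hk with ⟨hk, -⟩ | ⟨-, hlt, -⟩
      · exact absurd hj' hk
      · rcases hk' with ⟨hk', -⟩ | ⟨-, hlt', -⟩
        · exact absurd hj hk'
        · exact absurd hlt hlt'.asymm

theorem hasCoeffs_coeffDiagram : HasCoeffs (coeffDiagram F a c r s) F a c r s where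
  green j hj := if_pos hj
  red k hk := if_neg hk
  green_phase j hj := if_pos hj
  red_phase k hk := if_neg hk
  plain j k hj hk := by
    constructor
    · rintro ⟨⟨⟨i, l⟩, hi, hl⟩, he, (hs : s(i, l) = s(j, k))⟩
      have he' : l ∉ F := of_decide_eq_false he
      rcases Sym2.eq_iff.1 hs with ⟨rfl, rfl⟩ | ⟨rfl, rfl⟩
      · rcases hl with hl | hl
        · exact hl.2
        · exact absurd hl.1 he'
      · exact absurd hj he'
    · intro h
      exact ⟨⟨(j, k), hj, .inl ⟨hk, h⟩⟩, decide_eq_false hk, rfl⟩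
  hadamard j k hj hk hjk := by
    constructor
    · rintro ⟨⟨⟨i, l⟩, hi, hl⟩, he, (hs : s(i, l) = s(j, k))⟩
      have he' : l ∈ F := of_decide_eq_true he
      rcases hl with hl | ⟨-, hlt, hl⟩
      · exact absurd he' hl.1
      · rcases Sym2.eq_iff.1 hs with ⟨rfl, rfl⟩ | ⟨rfl, rfl⟩
        · exact hl
        · exact absurd hjk hlt.asymm
    · intro h
      exact ⟨⟨(j, k), hj, .inr ⟨hk, hjk, h⟩⟩, decide_eq_true hk, rfl⟩

end coeffDiagram

theorem angle_val_intCast_mul (m : ℤ) :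
    ((m * (Real.pi / 2) : ℝ) : Real.Angle) =
      ((((m : ZMod 4)).val * (Real.pi / 2) : ℝ) : Real.Angle) := by
  rw [Real.Angle.angle_eq_iff_two_pi_dvd_sub]
  refine ⟨m / 4, ?_⟩
  have h1 : (((m : ZMod 4)).val : ℤ) = m % 4 := ZMod.val_intCast m
  have h2 : (((m : ZMod 4)).val : ℝ) = ((m % 4 : ℤ) : ℝ) := by rw [← h1]; norm_cast
  have h3 : (m : ℝ) = ((m % 4 : ℤ) : ℝ) + 4 * ((m / 4 : ℤ) : ℝ) := by
    exact_mod_cast (Int.emod_add_mul_ediv m 4).symm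
  rw [h2]
  linear_combination (Real.pi / 2) * h3

open Classical in
theorem ZXDiagram.IsPhasePolyForm.exists_hasCoeffs {n : ℕ} {D : ZXDiagram n}
    (hD : D.IsPhasePolyForm) : ∃ F a c r s, HasCoeffs D F a c r s := by
  have hr : ∀ j, ∃ r : ZMod 4, D.colour (D.out j) = Colour.green →
      D.phase (D.out j) = ((r.val * (Real.pi / 2) : ℝ) : Real.Angle) := by
    intro j
    by_cases h : D.colour (D.out j) = Colour.green
    · obtain ⟨m, hm⟩ := hD.green_phase _ h
      exact ⟨m, fun _ => hm.trans (angle_val_intCast_mul m)⟩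
    · exact ⟨0, fun h' => absurd h' h⟩
  choose r hr using hr
  have hred : ∀ {v}, D.colour v ≠ Colour.green → D.colour v = Colour.red := by
    intro v hv
    cases h : D.colour v
    · exact absurd h hv
    · rfl
  refine ⟨Finset.univ.filter fun j => D.colour (D.out j) = Colour.green,
    fun k => if D.phase (D.out k) = 0 then 0 else 1,
    fun k j => if D.PlainAdj (D.out j) (D.out k) then 1 else 0, r,
    fun j k => if D.HadamardAdj (D.out j) (D.out k) then 1 else 0, ?_⟩
  refine ⟨by simp, fun k hk => hred (by simpa using hk), by simpa using hr, fun k hk => ?_,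
    by simp, by simp⟩
  have hk' := hD.red_phase _ (hred (by simpa using hk))
  by_cases h0 : D.phase (D.out k) = 0
  · simp [h0]
  · simp only [if_neg h0, ZMod.val_one, Nat.cast_one, one_mul]
    exact hk'.resolve_left h0

/-! ### The translation -/

theorem EqUpToScalar.support_eq {n : ℕ} {ψ φ : State n} (h : EqUpToScalar ψ φ) :
    Function.support ψ = Function.support φ := by
  obtain ⟨z, hz, rfl⟩ := h
  exact Function.support_const_smul_of_ne_zero z _ hz

theorem ZXDiagram.IsTranslation.of_equiv {n : ℕ} {D D' : ZXDiagram n} {ψ ψ' : State n}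
    {F : Finset (Fin n)} (hF : IsFreeVariableSet (Function.support ψ) F)
    (hD' : D'.IsPhasePolyForm) (h : D.IsTranslation ψ F) (hD : D.Iso D')
    (hψ : EqUpToScalar ψ ψ') : D'.IsTranslation ψ' F := by
  have hF' := hF
  rw [EqUpToScalar.support_eq hψ] at hF'
  rw [isTranslation_iff hF] at h
  rw [isTranslation_iff hF']
  obtain ⟨-, a, c, r, s, hco, hst⟩ := h
  exact ⟨hD', a, c, r, s, hco.of_iso hD, hψ.symm.trans hst⟩

theorem ZXDiagram.IsTranslation.iso {n : ℕ} {D D' : ZXDiagram n} {ψ : State n}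
    {F : Finset (Fin n)} (hF : IsFreeVariableSet (Function.support ψ) F)
    (h : D.IsTranslation ψ F) (h' : D'.IsTranslation ψ F) : D.Iso D' := by
  rw [isTranslation_iff hF] at h h'
  obtain ⟨hD, a, c, r, s, hco, hst⟩ := h
  obtain ⟨hD', a', c', r', s', hco', hst'⟩ := h'
  exact hco.iso hD hD' hco' (coeffsAgree_of_eqUpToScalar (hst.symm.trans hst'))

/-- Translations of one pair are isomorphic, so the computation for `coeffDiagram` suffices. -/
theorem ZXDiagram.IsTranslation.interp {n : ℕ} {D : ZXDiagram n} {ψ : State n}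
    {F : Finset (Fin n)} (hF : IsFreeVariableSet (Function.support ψ) F)
    (h : D.IsTranslation ψ F) : EqUpToScalar D.interp ψ := by
  obtain ⟨-, a, c, r, s, -, hst⟩ := (isTranslation_iff hF).1 h
  have h' : (coeffDiagram F a c r s).IsTranslation ψ F := (isTranslation_iff hF).2
    ⟨isPhasePolyForm_coeffDiagram F a c r s, a, c, r, s, hasCoeffs_coeffDiagram F a c r s, hst⟩
  rw [(h.iso hF h').interp_eq]
  exact (interp_coeffDiagram F a c r s).trans hst.symm

theorem IsStabilizerState.exists_isTranslation {n : ℕ} {ψ : State n} (hψ : IsStabilizerState ψ)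
    {F : Finset (Fin n)} (hF : IsFreeVariableSet (Function.support ψ) F) :
    ∃ D : ZXDiagram n, D.IsTranslation ψ F := by
  obtain ⟨a, c, r, s, hst⟩ := hψ.exists_eq_smul_phaseState hF
  exact ⟨_, (isTranslation_iff hF).2
    ⟨isPhasePolyForm_coeffDiagram F a c r s, a, c, r, s, hasCoeffs_coeffDiagram F a c r s, hst⟩⟩

theorem ZXDiagram.IsPhasePolyForm.exists_pair {n : ℕ} {D : ZXDiagram n} (hD : D.IsPhasePolyForm) :
    ∃ P : StabilizerPair n, D.IsTranslation P.state P.free := by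
  obtain ⟨F, a, c, r, s, hco⟩ := hD.exists_hasCoeffs
  have hF : IsFreeVariableSet (Function.support (phaseState F a c r s)) F := by
    rw [support_phaseState]; exact isFreeVariableSet_affineSet F a c
  exact ⟨⟨phaseState F a c r s, F, isStabilizerState_phaseState F a c r s, hF⟩,
    (isTranslation_iff hF).2 ⟨hD, a, c, r, s, hco, .refl _⟩⟩

theorem ZXDiagram.IsTranslation.free_eq {n : ℕ} {D : ZXDiagram n} {ψ ψ' : State n}
    {F F' : Finset (Fin n)} (hF : IsFreeVariableSet (Function.support ψ) F)
    (hF' : IsFreeVariableSet (Function.support ψ') F')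
    (h : D.IsTranslation ψ F) (h' : D.IsTranslation ψ' F') : F = F' := by
  obtain ⟨-, a, c, r, s, hco, -⟩ := (isTranslation_iff hF).1 h
  obtain ⟨-, a', c', r', s', hco', -⟩ := (isTranslation_iff hF').1 h'
  ext j
  rw [hco.mem_iff, hco'.mem_iff]

theorem IsStabilizerState.isFreeVariableSet_canonicalFree {n : ℕ} {ψ : State n}
    (hψ : IsStabilizerState ψ) :
    IsFreeVariableSet (Function.support ψ) (canonicalFree (Function.support ψ)) :=
  ZXCalc.isFreeVariableSet_canonicalFree hψ.support_nonempty
    fun _ hx _ hy _ hz => hψ.add_add_mem_support hx hy hz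

theorem ZXDiagram.IsCanonicalForm.iso {n : ℕ} {D D' : ZXDiagram n} (hD : D.IsCanonicalForm)
    (hD' : D'.IsCanonicalForm) (h : EqUpToScalar D.interp D'.interp) : D.Iso D' := by
  obtain ⟨ψ, hψ, ht⟩ := hD
  obtain ⟨ψ', hψ', ht'⟩ := hD'
  have hF := hψ.isFreeVariableSet_canonicalFree
  have hF' := hψ'.isFreeVariableSet_canonicalFree
  have heq : EqUpToScalar ψ' ψ :=
    (ht'.interp hF').symm.trans (h.symm.trans (ht.interp hF))
  refine ht.iso hF (?_ : D'.IsTranslation ψ _)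
  rw [← EqUpToScalar.support_eq heq]
  exact ht'.of_equiv hF' ht'.1 (.refl _) heq

/-! ### Assembling the bijection. -/

theorem exists_equiv_of_existsUnique {α β : Type*} {R : α → β → Prop}
    (h₁ : ∀ a, ∃! b, R a b) (h₂ : ∀ b, ∃! a, R a b) :
    ∃ Φ : α ≃ β, ∀ a b, Φ a = b ↔ R a b := by
  choose f hf hf' using h₁
  choose g hg hg' using h₂
  refine ⟨⟨f, g, fun a => (hg' _ a (hf a)).symm, fun b => (hf' _ b (hg b)).symm⟩, fun a b => ?_⟩
  exact ⟨fun h => h ▸ hf a, fun h => (hf' a b h).symm⟩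

theorem exists_translationEquiv (n : ℕ) :
    ∃ Φ : StabilizerPairUpToScalar n ≃ PhasePolyDiagram n,
      ∀ (P : StabilizerPair n) (D : {D : ZXDiagram n // D.IsPhasePolyForm}),
        Φ ⟦P⟧ = ⟦D⟧ ↔ D.1.IsTranslation P.state P.free := by
  let R : StabilizerPairUpToScalar n → PhasePolyDiagram n → Prop := fun q d =>
    ∃ (P : StabilizerPair n) (D : {D : ZXDiagram n // D.IsPhasePolyForm}),
      ⟦P⟧ = q ∧ ⟦D⟧ = d ∧ D.1.IsTranslation P.state P.free
  have hR : ∀ (P : StabilizerPair n) (D : {D : ZXDiagram n // D.IsPhasePolyForm}),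
      R ⟦P⟧ ⟦D⟧ ↔ D.1.IsTranslation P.state P.free := by
    intro P D
    refine ⟨?_, fun h => ⟨P, D, rfl, rfl, h⟩⟩
    rintro ⟨P', D', hP, hD, h⟩
    obtain ⟨hψ, hfree⟩ := Quotient.exact hP
    rw [← hfree]
    exact h.of_equiv P'.isFreeVariableSet D.2 (Quotient.exact hD) hψ
  obtain ⟨Φ, hΦ⟩ := exists_equiv_of_existsUnique (R := R) (by
    intro q
    induction q using Quotient.inductionOn with | _ P
    obtain ⟨D, hD⟩ := P.isStabilizerState.exists_isTranslation P.isFreeVariableSet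
    refine ⟨⟦⟨D, hD.1⟩⟧, (hR _ _).2 hD, fun d hd => ?_⟩
    induction d using Quotient.inductionOn with | _ D'
    exact Quotient.sound (((hR _ _).1 hd).iso P.isFreeVariableSet hD)) (by
    intro d
    induction d using Quotient.inductionOn with | _ D
    obtain ⟨P, hP⟩ := D.2.exists_pair
    refine ⟨⟦P⟧, (hR _ _).2 hP, fun q hq => ?_⟩
    induction q using Quotient.inductionOn with | _ P'
    have hP' := (hR _ _).1 hq
    -- The diagram gives back both components of the pair: the state by its interpretation, the free
    -- variables by its colours.
    exact Quotient.sound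
      ⟨(hP'.interp P'.isFreeVariableSet).symm.trans (hP.interp P.isFreeVariableSet),
        hP'.free_eq P'.isFreeVariableSet P.isFreeVariableSet hP⟩)
  exact ⟨Φ, fun P D => (hΦ _ _).trans (hR P D)⟩

end ZXCalc

theorem mainTheorem3 (n : ℕ) :
    ∃ Φ : StabilizerPairUpToScalar n ≃ PhasePolyDiagram n,
      -- `Φ` is given by the explicit translation of pairs into diagrams
      (∀ (P : StabilizerPair n) (D : {D : ZXDiagram n // D.IsPhasePolyForm}),
        Φ ⟦P⟧ = ⟦D⟧ ↔ D.1.IsTranslation P.state P.free) ∧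
      -- the diagram assigned to `(ψ, F)` denotes `ψ` up to a non-zero scalar
      (∀ (P : StabilizerPair n) (D : {D : ZXDiagram n // D.IsPhasePolyForm}),
        Φ ⟦P⟧ = ⟦D⟧ → EqUpToScalar D.1.interp P.state) ∧
      -- every stabilizer state has exactly one canonical diagram, the image of `(ψ, F)` under `Φ`
      (∀ (ψ : State n) (hψ : IsStabilizerState ψ),
        (∃ A : AffineSubspace (ZMod 2) (Bits n), (A : Set (Bits n)) = Function.support ψ) ∧
        ∃ hF : IsFreeVariableSet (Function.support ψ) (canonicalFree (Function.support ψ)),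
          (∃! C : PhasePolyDiagram n,
            ∃ D : {D : ZXDiagram n // D.IsPhasePolyForm}, ⟦D⟧ = C ∧ D.1.IsCanonicalDiagram ψ) ∧
          ∃ D : {D : ZXDiagram n // D.IsPhasePolyForm},
            Φ ⟦⟨ψ, canonicalFree (Function.support ψ), hψ, hF⟩⟧ = ⟦D⟧ ∧
              D.1.IsCanonicalDiagram ψ) ∧
      -- equivalent diagrams in canonical form are the same diagram
      (∀ D D' : ZXDiagram n, D.IsCanonicalForm → D'.IsCanonicalForm →
        EqUpToScalar D.interp D'.interp → D.Iso D') := by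
  obtain ⟨Φ, hΦ⟩ := exists_translationEquiv n
  refine ⟨Φ, hΦ, fun P D h => ((hΦ P D).1 h).interp P.isFreeVariableSet, fun ψ hψ => ?_,
    fun D D' hD hD' h => hD.iso hD' h⟩
  have hF := hψ.isFreeVariableSet_canonicalFree
  obtain ⟨D, hD⟩ := hψ.exists_isTranslation hF
  refine ⟨hψ.exists_affineSubspace, hF, ⟨⟦⟨D, hD.1⟩⟧, ⟨⟨D, hD.1⟩, rfl, hD⟩, ?_⟩,
    ⟨D, hD.1⟩, (hΦ _ _).2 hD, hD⟩
  rintro _ ⟨D', rfl, hD'⟩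
  exact Quotient.sound (ZXDiagram.IsTranslation.iso hF hD' hD)
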